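/- Let $d\ge 1$, let $\mathcal X\subset\mathbb R^d$ be compact, and let $x,x'\in\mathcal X$ be query points at which $\mathcal X$ is not thin: for some $\kappa>0$, $\mathrm{vol}(\mathcal X\cap B(x,r))\ge\kappa r^d$ and $\mathrm{vol}(\mathcal X\cap B(x',r))\ge\kappa r^d$ for all $0<r\le 1$ (e.g. interior points). Let $0<\beta\le1$, $L>0$, and let $\mathcal F(\beta,L)$ be the set of symmetric functions $f:\mathcal X\times\mathcal X\to\mathbb R$ with $|f(a,b)-f(\tilde a,b)|\le L\|a-\tilde a\|^\beta$ and $|f(a,b)|\le L$ for all $a,\tilde a,b\in\mathcal X$. Given covariates $X_1,\dots,X_n\in\mathcal X$, the outcomes $Y_{ij}=Y_{ji}$, $1\le i<j\le n$, are independent with normal law $Y_{ij}\sim N\big(f(X_i,X_j),\sigma^2(X_i,X_j)\big)$, where $\sigma^2$ is a symmetric measurable function (for instance a constant) with $\sigma_0^2\le\sigma^2<\tau$ for constants $\sigma_0^2,\tau>0$. The covariates satisfy one of the following. (a) Fixed design: for each $n\geq 1$, $X_1,\dots,X_n\in\mathcal X$ are deterministic (forming a triangular array), with $\|X_i-X_j\|\ge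 c_Xn^{-1/d}$ for $i\ne j$ and $\sup_{z\in\mathcal X}\min_j\|z-X_j\|\le C_Xn^{-1/d}$, for constants $c_X,C_X>0$ not depending on $n$. (b) Random design: $X_1,\dots,X_n$ are i.i.d. with a continuous Lebesgue density $m$ on $\mathcal X$, $0<l\le m\le u<\infty$. Let $K$ be a bounded, compactly supported, symmetric probability density on $\mathbb R^d$ (with mean zero and finite second moment) such that $\underline k\,\sup_zK(z)\le\inf_{\|z\|\le r}K(z)$ for some $\underline k,r>0$. Put $K_h(z)=h^{-d}K(z/h)$, and let $$\hat f_{n,h}(x,x')=\frac{\sum_{i\ne j}Y_{ij}\{K_h(x-X_i)K_h(x'-X_j)+\lambda_n\}}{\sum_{i\ne j}\{K_h(x-X_i)K_h(x'-X_j)+\lambda_n\}},\qquad h=n^{-1/(\beta+d)},$$ where, for some $\nu>0$, $(nh^d)^{-\nu}\le\lambda_n\le h^d$ for all $n\ge1$. Then, in either design, $$\limsup_{n\to\infty}\ \frac{\sup_{f\in\mathcal F(\beta,L)}\mathbb E|f(x,x')-\hat f_{n,h}(x,x')|^2}{\inf_{\hat f_n}\sup_{f\in\mathcal F(\beta,L)}\mathbb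 E|f(x,x')-\hat f_n(x,x')|^2}<\infty,$$ where the infimum is over all measurable functions $\hat f_n(x,x')$ of the data $(X_i)_i,(Y_{ij})_{i<j}$. Moreover the minimax risk is of order $n^{-2\beta/(\beta+d)}$: there are constants $c,C>0$ such that for all sufficiently large $n$ $$c\,n^{-2\beta/(\beta+d)}\le\inf_{\hat f_n}\sup_{f\in\mathcal F(\beta,L)}\mathbb E|f(x,x')-\hat f_n(x,x')|^2\le C\,n^{-2\beta/(\beta+d)} .$$ -/

import Mathlib

open MeasureTheory ProbabilityTheory Filter
open scoped NNReal ENNReal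

namespace LinkRegression

noncomputable section

/-- `d`-dimensional Euclidean space. -/
abbrev Space (d : ℕ) : Type := EuclideanSpace ℝ (Fin d)

/-- The links of a graph on `n` nodes: unordered pairs of distinct nodes, written with the smaller
index first. -/
abbrev Link (n : ℕ) : Type := {p : Fin n × Fin n // p.1 < p.2}

variable {d : ℕ}

/-- The class `𝓕(β, L)` of link regression functions on `𝒳 × 𝒳`: symmetric, bounded by `L`, and
`β`-Hölder with constant `L` in one (hence, by symmetry, in each) argument. -/
def holderClass (𝒳 : Set (Space d)) (β L : ℝ) : Set (𝒳 → 𝒳 → ℝ) :=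
  {f | (∀ a b, f a b = f b a) ∧
    (∀ a a' b, |f a b - f a' b| ≤ L * ‖(a : Space d) - (a' : Space d)‖ ^ β) ∧
    (∀ a b, |f a b| ≤ L)}

/-- Conditions on the `d`-variate kernel `K`. -/
structure IsKernel (K : Space d → ℝ) : Prop where
  measurable : Measurable K
  nonneg : ∀ z, 0 ≤ K z
  bounded : BddAbove (Set.range K)
  compactSupport : HasCompactSupport K
  symmetric : ∀ z, K (-z) = K z
  integral_eq_one : ∫ z, K z = 1
  mean_zero : ∫ z, K z • z = 0
  secondMoment : Integrable (fun z => ‖z‖ ^ 2 * K z)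
  lower_on_ball : ∃ k r : ℝ, 0 < k ∧ 0 < r ∧ ∀ z, ‖z‖ ≤ r → k * (⨆ w, K w) ≤ K z

/-- The rescaled kernel `K_h(z) = h^{-d} K(z / h)`. -/
def scaledKernel (K : Space d → ℝ) (h : ℝ) (z : Space d) : ℝ :=
  (h ^ d)⁻¹ * K (h⁻¹ • z)

/-- The symmetric outcome `Y_{ij} = Y_{ji}`, `i ≠ j`, read off from the outcomes at the links
(the diagonal value is never used). -/
def outcome {n : ℕ} (Y : Link n → ℝ) (i j : Fin n) : ℝ :=
  if hij : i < j then Y ⟨(i, j), hij⟩ else if hji : j < i then Y ⟨(j, i), hji⟩ else 0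

/-- The kernel smoother at the query `(x, x')` with bandwidth `h` and regularization parameter
`lam`, as a function of the data (covariates, outcomes at links). -/
def kernelSmoother {𝒳 : Set (Space d)} (K : Space d → ℝ) (h lam : ℝ) (x x' : 𝒳) (n : ℕ) :
    (Fin n → 𝒳) × (Link n → ℝ) → ℝ := fun D =>
  let w : Fin n → Fin n → ℝ := fun i j =>
    scaledKernel K h ((x : Space d) - (D.1 i : Space d)) *
      scaledKernel K h ((x' : Space d) - (D.1 j : Space d)) + lam
  let I : Finset (Fin n × Fin n) := Finset.univ.filter (fun p => p.1 ≠ p.2)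
  ((I.card : ℝ)⁻¹ * ∑ p ∈ I, outcome D.2 p.1 p.2 * w p.1 p.2) /
    ((I.card : ℝ)⁻¹ * ∑ p ∈ I, w p.1 p.2)

/-- The joint law of the outcomes given the covariates `X`, for the normal model: independent over
links, `Y_{ij} ∼ N(f(X_i, X_j), v(X_i, X_j))`. -/
def outcomeLaw {𝒳 : Set (Space d)} {n : ℕ} (f : 𝒳 → 𝒳 → ℝ) (v : 𝒳 → 𝒳 → ℝ≥0)
    (X : Fin n → 𝒳) : Measure (Link n → ℝ) :=
  Measure.pi fun p : Link n =>
    gaussianReal (f (X p.1.1) (X p.1.2)) (v (X p.1.1) (X p.1.2))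

/-- The quadratic risk `𝔼 |f(x, x') - T|²` of the estimator `T`, when the covariates have the joint
law `P` (a point mass for a deterministic design) and `f` is the link regression function. -/
def risk {𝒳 : Set (Space d)} {n : ℕ} (P : Measure (Fin n → 𝒳)) (v : 𝒳 → 𝒳 → ℝ≥0) (x x' : 𝒳)
    (T : (Fin n → 𝒳) × (Link n → ℝ) → ℝ) (f : 𝒳 → 𝒳 → ℝ) : ℝ≥0∞ :=
  ∫⁻ X, ∫⁻ Y, ENNReal.ofReal ((f x x' - T (X, Y)) ^ 2) ∂(outcomeLaw f v X) ∂P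

/-- The maximal risk of the estimator `T` over `𝓕(β, L)`. -/
def maxRisk {𝒳 : Set (Space d)} {n : ℕ} (β L : ℝ) (P : Measure (Fin n → 𝒳)) (v : 𝒳 → 𝒳 → ℝ≥0)
    (x x' : 𝒳) (T : (Fin n → 𝒳) × (Link n → ℝ) → ℝ) : ℝ≥0∞ :=
  ⨆ f ∈ holderClass 𝒳 β L, risk P v x x' T f

/-- The minimax risk at `(x, x')` over `𝓕(β, L)`: the infimum of the maximal risk over all
(measurable) estimators. -/
def minimaxRisk {𝒳 : Set (Space d)} {n : ℕ} (β L : ℝ) (P : Measure (Fin n → 𝒳))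
    (v : 𝒳 → 𝒳 → ℝ≥0) (x x' : 𝒳) : ℝ≥0∞ :=
  ⨅ (T : (Fin n → 𝒳) × (Link n → ℝ) → ℝ) (_ : Measurable T), maxRisk β L P v x x' T

/-- Fixed design: `P n` is the point mass at a deterministic array of `n` nearly equispaced points
of `𝒳`: distinct points are at least `c n^{-1/d}` apart, and every point of `𝒳` is within
`C n^{-1/d}` of a design point. -/
def IsFixedDesign (𝒳 : Set (Space d)) (P : ∀ n : ℕ, Measure (Fin n → 𝒳)) : Prop :=
  ∃ (X : ∀ n : ℕ, Fin n → 𝒳) (c C : ℝ), 0 < c ∧ 0 < C ∧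
    (∀ n : ℕ, 1 ≤ n →
      (∀ i j, i ≠ j → c / (n : ℝ) ^ (1 / (d : ℝ)) ≤ ‖(X n i : Space d) - (X n j : Space d)‖) ∧
      (∀ z : 𝒳, ∃ j, ‖(z : Space d) - (X n j : Space d)‖ ≤ C / (n : ℝ) ^ (1 / (d : ℝ)))) ∧
    ∀ n, P n = Measure.dirac (X n)

/-- Random design: under `P n` the `n` covariates are i.i.d. with a continuous Lebesgue density `m`
on `𝒳`, bounded from above and from below by positive constants. -/
def IsRandomDesign (𝒳 : Set (Space d)) (P : ∀ n : ℕ, Measure (Fin n → 𝒳)) : Prop :=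
  ∃ (m : 𝒳 → ℝ) (l u : ℝ), Continuous m ∧ 0 < l ∧ (∀ z, l ≤ m z ∧ m z ≤ u) ∧
    ∫⁻ z, ENNReal.ofReal (m z) ∂(Measure.comap Subtype.val (volume : Measure (Space d))) = 1 ∧
    ∀ n, P n = Measure.pi fun _ : Fin n =>
      (Measure.comap Subtype.val (volume : Measure (Space d))).withDensity
        fun z : 𝒳 => ENNReal.ofReal (m z)

/-- `𝒳` is not thin at `x`: `vol (𝒳 ∩ B(x, r)) ≥ κ r^d` for small radii. This holds at every
interior point, and at every point of a ball, a cube, or a convex body. -/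
def IsThickAt (𝒳 : Set (Space d)) (x : Space d) : Prop :=
  ∃ κ : ℝ, 0 < κ ∧ ∀ r : ℝ, 0 < r → r ≤ 1 →
    ENNReal.ofReal (κ * r ^ d) ≤ volume (𝒳 ∩ Metric.closedBall x r)

/-- The bandwidth `h = n^{-1/(β+d)}`. -/
def bandwidth (β : ℝ) (d n : ℕ) : ℝ := (n : ℝ) ^ (-(1 / (β + (d : ℝ))))

end

end LinkRegression

/-! The bandwidth solves `n h^d = h^(-β)`. About `n h^d` design points lie within distance of order
`h` of each query point, so about `(n h^d)^2` links are informative. The variance `(n h^d)^(-2)` and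
the squared bias `h^(2β)` then agree, and both equal `n^(-2β/(β+d))`.

Upper bound. Given the design, the smoother is a weighted average of independent Gaussians, so its
risk is exactly squared bias plus variance (`lintegral_sq_sub_linear`). Links inside the kernel
support have bias `O(h^β)` by Hölder continuity. The regularization adds `O(λ)`, and `λ ≤ h^d ≤ h^β`
because `β ≤ 1 ≤ d`. The variance is at most the noise level times the largest weight. All this
needs a total weight of order `n^2`, which holds when both query points have order `n h^d`
neighbours (`conditional_risk_le_of_near`). On other designs the risk is still bounded, since `λ >
0` keeps the weights well defined, and such designs have probability `O(h^(2β))`: a covering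
argument rules them out for large `n` in the fixed case, and a Chernoff bound controls them in the
random case (the two `measure_few_near`).

Lower bound. The zero function is tested against a symmetrized bump of height `M h^β` supported on
pairs near `(x, x')` or `(x', x)`. Given the design, the second moment of the likelihood ratio is
`exp S`, with `S` at most a constant times `M^2 h^(2β)` times the number of links joining the two
neighbourhoods. `gaussian_two_point` is affine in `S`, so only the expected number of such links
matters, and it is `O((n h^d)^2)` (the two `lintegral_near_pairs`). A small `M` makes the
expectation of this bound on `S` at most `1/2`. -/

namespace LinkRegression

/-! ### Product Gaussian laws: likelihood ratios and linear statistics. -/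

section Gaussian

lemma lintegral_pi_prod {ι : Type*} [Fintype ι] {α : ι → Type*} [∀ i, MeasurableSpace (α i)]
    (μ : ∀ i, Measure (α i)) [∀ i, IsProbabilityMeasure (μ i)] (f : ∀ i, α i → ℝ≥0∞)
    (hf : ∀ i, Measurable (f i)) :
    ∫⁻ y, ∏ i, f i (y i) ∂(Measure.pi μ) = ∏ i, ∫⁻ y, f i y ∂(μ i) := by
  have hind : iIndepFun (fun i (y : ∀ i, α i) => f i (y i)) (Measure.pi μ) :=
    iIndepFun_pi fun i => (hf i).aemeasurable
  rw [lintegral_prod_eq_prod_lintegral_of_indepFun Finset.univ _ hind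
    fun i => (hf i).comp (measurable_pi_apply i)]
  refine Finset.prod_congr rfl fun i _ => ?_
  rw [← (measurePreserving_eval μ i).lintegral_comp (hf i)]

/-- It suffices to compare the two measures on boxes, where the indicator times the product density
factorizes over coordinates. -/
lemma pi_withDensity_eq {ι : Type*} [Fintype ι] {α : ι → Type*} [∀ i, MeasurableSpace (α i)]
    (μ ν : ∀ i, Measure (α i)) [∀ i, IsProbabilityMeasure (μ i)]
    [∀ i, IsProbabilityMeasure (ν i)] (f : ∀ i, α i → ℝ≥0∞) (hf : ∀ i, Measurable (f i))
    (h : ∀ i, ν i = (μ i).withDensity (f i)) :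
    Measure.pi ν = (Measure.pi μ).withDensity fun y => ∏ i, f i (y i) := by
  refine Measure.pi_eq fun s hs => ?_
  rw [withDensity_apply _ (MeasurableSet.univ_pi hs),
    ← lintegral_indicator (MeasurableSet.univ_pi hs)]
  have : ∀ y : ∀ i, α i, (Set.univ.pi s).indicator (fun y => ∏ i, f i (y i)) y
      = ∏ i, (s i).indicator (f i) (y i) := by
    intro y
    by_cases hy : y ∈ Set.univ.pi s
    · rw [Set.indicator_of_mem hy]
      exact Finset.prod_congr rfl fun i _ => (Set.indicator_of_mem (hy i trivial) _).symm
    · rw [Set.indicator_of_notMem hy]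
      simp only [Set.mem_pi, Set.mem_univ, true_imp_iff, not_forall] at hy
      obtain ⟨i, hi⟩ := hy
      exact (Finset.prod_eq_zero (Finset.mem_univ i) (Set.indicator_of_notMem hi _)).symm
  simp_rw [this]
  rw [lintegral_pi_prod μ _ fun i => (hf i).indicator (hs i)]
  refine Finset.prod_congr rfl fun i _ => ?_
  rw [lintegral_indicator (hs i), h i, withDensity_apply _ (hs i)]

lemma gaussianReal_eq_withDensity (m : ℝ) {v : ℝ≥0} (hv : v ≠ 0) :
    gaussianReal m v = (gaussianReal 0 v).withDensity
      fun y => ENNReal.ofReal (Real.exp (m / v * y - m ^ 2 / (2 * v))) := by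
  have hv' : (v : ℝ) ≠ 0 := by exact_mod_cast hv
  rw [gaussianReal_of_var_ne_zero _ hv, gaussianReal_of_var_ne_zero _ hv,
    ← withDensity_mul _ (measurable_gaussianPDF _ _) (by fun_prop)]
  congr 1
  ext y
  simp only [Pi.mul_apply, gaussianPDF]
  rw [← ENNReal.ofReal_mul (gaussianPDFReal_nonneg _ _ _)]
  congr 1
  simp only [gaussianPDFReal]
  conv_rhs => rw [mul_assoc, ← Real.exp_add]
  congr 2
  field_simp
  ring

/-- One coordinate's factor of the second moment of the likelihood ratio (`1 + χ²`), read off from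
the Gaussian moment generating function. -/
lemma lintegral_exp_sq_gaussianReal (m : ℝ) {v : ℝ≥0} (hv : v ≠ 0) :
    ∫⁻ y, ENNReal.ofReal (Real.exp (m / v * y - m ^ 2 / (2 * v))) ^ 2 ∂(gaussianReal 0 v)
      = ENNReal.ofReal (Real.exp (m ^ 2 / v)) := by
  have hv' : (v : ℝ) ≠ 0 := by exact_mod_cast hv
  have h1 : ∀ y : ℝ, ENNReal.ofReal (Real.exp (m / v * y - m ^ 2 / (2 * v))) ^ 2
      = ENNReal.ofReal (Real.exp (-(m ^ 2 / v)) * Real.exp ((2 * m / v) * y)) := by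
    intro y
    rw [← ENNReal.ofReal_pow (Real.exp_pos _).le, ← Real.exp_nat_mul, ← Real.exp_add]
    congr 2
    push_cast
    field_simp
    ring
  simp_rw [h1]
  rw [← ofReal_integral_eq_lintegral_ofReal
    ((integrable_exp_mul_gaussianReal _).const_mul _) (Eventually.of_forall fun y => by positivity),
    integral_const_mul]
  have := congrFun (mgf_fun_id_gaussianReal (μ := 0) (v := v)) (2 * m / v)
  simp only [mgf] at this
  rw [this, ← Real.exp_add]
  congr 2
  field_simp
  ring

/-- Two-point bound for a product of Gaussian laws: if `S` bounds the sum of the squared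
standardized means, no `T` estimates `0` under the centred law and `θ` under the shifted one. -/
lemma gaussian_two_point {ι : Type*} [Fintype ι] (m : ι → ℝ) (v : ι → ℝ≥0) (hv : ∀ i, v i ≠ 0)
    (T : (ι → ℝ) → ℝ) (hT : Measurable T) (θ S : ℝ) (hS : ∑ i, m i ^ 2 / v i ≤ S) :
    ENNReal.ofReal (θ ^ 2 / 2 * (1 - S)) ≤
      ∫⁻ y, ENNReal.ofReal ((0 - T y) ^ 2) ∂(Measure.pi fun i => gaussianReal 0 (v i)) +
      ∫⁻ y, ENNReal.ofReal ((θ - T y) ^ 2) ∂(Measure.pi fun i => gaussianReal (m i) (v i)) := by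
  set S' := ∑ i, m i ^ 2 / v i with hS'
  have hS0 : 0 ≤ S' := Finset.sum_nonneg fun i _ => by positivity
  set P0 := Measure.pi fun i => gaussianReal 0 (v i)
  set P1 := Measure.pi fun i => gaussianReal (m i) (v i)
  let g : ι → ℝ → ℝ := fun i y => Real.exp (m i / v i * y - m i ^ 2 / (2 * v i))
  have hg : ∀ i, Measurable (g i) := fun i => by fun_prop
  let ℓ : (ι → ℝ) → ℝ := fun y => ∏ i, g i (y i)
  have hℓ0 : ∀ y, 0 ≤ ℓ y := fun y => Finset.prod_nonneg fun i _ => (Real.exp_pos _).le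
  have hℓm : Measurable ℓ :=
    Finset.measurable_prod _ fun i _ => (hg i).comp (measurable_pi_apply i)
  have hℓ : ∀ y, ENNReal.ofReal (ℓ y) = ∏ i, ENNReal.ofReal (g i (y i)) := fun y =>
    ENNReal.ofReal_prod_of_nonneg fun i _ => (Real.exp_pos _).le
  have hP1 : P1 = P0.withDensity fun y => ENNReal.ofReal (ℓ y) := by
    rw [funext hℓ]
    exact pi_withDensity_eq (fun i => gaussianReal 0 (v i)) (fun i => gaussianReal (m i) (v i))
      (fun i y => ENNReal.ofReal (g i y)) (fun i => (hg i).ennreal_ofReal)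
      fun i => gaussianReal_eq_withDensity (m i) (hv i)
  have hint1 : ∫⁻ y, ENNReal.ofReal (ℓ y) ∂P0 = 1 := by
    have : P1 Set.univ = 1 := measure_univ
    rwa [hP1, withDensity_apply _ MeasurableSet.univ, Measure.restrict_univ] at this
  have hint2 : ∫⁻ y, ENNReal.ofReal (ℓ y ^ 2) ∂P0 = ENNReal.ofReal (Real.exp S') := by
    have : ∀ y, ENNReal.ofReal (ℓ y ^ 2) = ∏ i, ENNReal.ofReal (g i (y i)) ^ 2 := fun y => by
      rw [ENNReal.ofReal_pow (hℓ0 y), hℓ, Finset.prod_pow]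
    rw [lintegral_congr this,
      lintegral_pi_prod (fun i => gaussianReal 0 (v i)) (fun i y => ENNReal.ofReal (g i y) ^ 2)
        fun i => (hg i).ennreal_ofReal.pow_const 2,
      hS', Real.exp_sum, ENNReal.ofReal_prod_of_nonneg fun i _ => (Real.exp_pos _).le]
    exact Finset.prod_congr rfl fun i _ => lintegral_exp_sq_gaussianReal (m i) (hv i)
  set A := ∫⁻ y, ENNReal.ofReal ((0 - T y) ^ 2) ∂P0
  set B := ∫⁻ y, ENNReal.ofReal ((θ - T y) ^ 2) ∂P1 with hB
  have hB' : B = ∫⁻ y, ENNReal.ofReal (ℓ y * (θ - T y) ^ 2) ∂P0 := by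
    rw [hB, hP1, lintegral_withDensity_eq_lintegral_mul _ hℓm.ennreal_ofReal (by fun_prop)]
    refine lintegral_congr fun y => ?_
    rw [Pi.mul_apply, ENNReal.ofReal_mul (hℓ0 y)]
  -- Split `θ² ℓ = θ T ℓ + θ (θ - T) ℓ` and apply AM-GM to each part. The weights `exp (±S')` are
  -- chosen so that the `ℓ²` term integrates to exactly `θ² / 4`, because `ℓ²` has integral `exp
  -- S'`.
  have hpt : ∀ y, 3 / 4 * θ ^ 2 * ℓ y ≤ Real.exp S' * (0 - T y) ^ 2 + ℓ y * (θ - T y) ^ 2 +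
      θ ^ 2 / 4 * Real.exp (-S') * ℓ y ^ 2 := by
    intro y
    have e1 : Real.exp (-S') = (Real.exp S')⁻¹ := Real.exp_neg _
    have e2 := Real.exp_pos S'
    have key1 : θ * T y * ℓ y ≤ Real.exp S' * (T y) ^ 2 +
        θ ^ 2 / 4 * Real.exp (-S') * ℓ y ^ 2 := by
      have : Real.exp S' * (T y) ^ 2 + θ ^ 2 / 4 * Real.exp (-S') * ℓ y ^ 2 - θ * T y * ℓ y
          = Real.exp (-S') * (Real.exp S' * T y - θ * ℓ y / 2) ^ 2 := by
        rw [e1]; field_simp; ring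
      have h2 : 0 ≤ Real.exp (-S') * (Real.exp S' * T y - θ * ℓ y / 2) ^ 2 := by positivity
      linarith
    have key2 : θ * (θ - T y) * ℓ y ≤ ℓ y * (θ - T y) ^ 2 + θ ^ 2 / 4 * ℓ y := by
      have := mul_nonneg (hℓ0 y) (sq_nonneg (θ / 2 - (θ - T y)))
      nlinarith
    nlinarith
  have hint : ENNReal.ofReal (3 / 4 * θ ^ 2) ≤
      ENNReal.ofReal (Real.exp S') * A + B + ENNReal.ofReal (θ ^ 2 / 4) := by
    calc ENNReal.ofReal (3 / 4 * θ ^ 2)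
        = ∫⁻ y, ENNReal.ofReal (3 / 4 * θ ^ 2 * ℓ y) ∂P0 := by
          simp_rw [ENNReal.ofReal_mul (show 0 ≤ 3 / 4 * θ ^ 2 by positivity)]
          rw [lintegral_const_mul _ hℓm.ennreal_ofReal, hint1, mul_one]
      _ ≤ ∫⁻ y, (ENNReal.ofReal (Real.exp S') * ENNReal.ofReal ((0 - T y) ^ 2) +
            ENNReal.ofReal (ℓ y * (θ - T y) ^ 2) +
            ENNReal.ofReal (θ ^ 2 / 4 * Real.exp (-S')) * ENNReal.ofReal (ℓ y ^ 2)) ∂P0 := by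
          refine lintegral_mono fun y => ?_
          have h1 := hℓ0 y
          rw [← ENNReal.ofReal_mul (by positivity), ← ENNReal.ofReal_mul (by positivity),
            ← ENNReal.ofReal_add (by positivity) (by positivity),
            ← ENNReal.ofReal_add (by positivity) (by positivity)]
          exact ENNReal.ofReal_le_ofReal (hpt y)
      _ = _ := by
          rw [lintegral_add_left (by fun_prop), lintegral_add_left (by fun_prop),
            lintegral_const_mul _ (by fun_prop), lintegral_const_mul _ (by fun_prop), ← hB',
            hint2, ← ENNReal.ofReal_mul (by positivity), mul_assoc, ← Real.exp_add,
            neg_add_cancel, Real.exp_zero, mul_one]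
  have hhalf : ENNReal.ofReal (θ ^ 2 / 2) ≤ ENNReal.ofReal (Real.exp S') * A + B := by
    have : 3 / 4 * θ ^ 2 = θ ^ 2 / 2 + θ ^ 2 / 4 := by ring
    rw [this, ENNReal.ofReal_add (by positivity) (by positivity)] at hint
    exact (ENNReal.add_le_add_iff_right ENNReal.ofReal_ne_top).1 hint
  -- The inequality `exp (-S') ≥ 1 - S'` makes the bound affine in `S`, which is what allows it to
  -- be averaged over a random design.
  calc ENNReal.ofReal (θ ^ 2 / 2 * (1 - S))
      ≤ ENNReal.ofReal (Real.exp (-S') * (θ ^ 2 / 2)) := by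
        refine ENNReal.ofReal_le_ofReal ?_
        have := Real.add_one_le_exp (-S')
        nlinarith [sq_nonneg θ]
    _ ≤ ENNReal.ofReal (Real.exp (-S')) * (ENNReal.ofReal (Real.exp S') * (A + B)) := by
        rw [ENNReal.ofReal_mul (by positivity)]
        refine mul_le_mul_right (hhalf.trans ?_) _
        rw [mul_add]
        gcongr
        refine le_mul_of_one_le_left (by simp) ?_
        rw [ENNReal.one_le_ofReal]
        exact Real.one_le_exp hS0
    _ = A + B := by
        rw [← mul_assoc, ← ENNReal.ofReal_mul (by positivity), ← Real.exp_add]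
        simp

/-- The risk of a linear function of independent Gaussian variables: squared bias plus variance. -/
lemma lintegral_sq_sub_linear {ι : Type*} [Fintype ι] (m : ι → ℝ) (v : ι → ℝ≥0) (a : ι → ℝ)
    (c : ℝ) :
    ∫⁻ y, ENNReal.ofReal ((c - ∑ i, a i * y i) ^ 2)
        ∂(Measure.pi fun i => gaussianReal (m i) (v i)) =
      ENNReal.ofReal ((c - ∑ i, a i * m i) ^ 2 + ∑ i, a i ^ 2 * v i) := by
  set P := Measure.pi fun i => gaussianReal (m i) (v i)
  have hmem : ∀ i, MemLp (fun y : ℝ => a i * y) 2 (gaussianReal (m i) (v i)) := fun i =>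
    (memLp_id_gaussianReal' 2 (by simp)).const_mul (a i)
  have hmem' : ∀ i, MemLp (fun y : ι → ℝ => a i * y i) 2 P := fun i =>
    (hmem i).comp_measurePreserving (measurePreserving_eval _ i)
  have hsum : MemLp (fun y : ι → ℝ => ∑ i, a i * y i) 2 P :=
    memLp_finsetSum _ fun i _ => hmem' i
  have hmean : ∫ y, ∑ i, a i * y i ∂P = ∑ i, a i * m i := by
    rw [integral_finsetSum _ fun i _ => (hmem' i).integrable (by norm_num)]
    refine Finset.sum_congr rfl fun i _ => ?_
    rw [integral_const_mul]
    congr 1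
    exact (integral_comp_eval (μ := fun i => gaussianReal (m i) (v i)) (i := i)
      (f := fun y : ℝ => y) (by fun_prop)).trans integral_id_gaussianReal
  have hvar : Var[fun y : ι → ℝ => ∑ i, a i * y i; P] = ∑ i, a i ^ 2 * v i := by
    have h := variance_sum_pi (X := fun i (y : ℝ) => a i * y) hmem
    have h' : (∑ i, fun y : ι → ℝ => a i * y i) = fun y => ∑ i, a i * y i := by
      ext y
      simp
    rw [h'] at h
    refine h.trans (Finset.sum_congr rfl fun i _ => ?_)
    rw [variance_const_mul, variance_fun_id_gaussianReal]
  have hsub : MemLp (fun y : ι → ℝ => c - ∑ i, a i * y i) 2 P := (memLp_const c).sub hsum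
  rw [← ofReal_integral_eq_lintegral_ofReal hsub.integrable_sq
    (Eventually.of_forall fun y => sq_nonneg _)]
  congr 1
  have h1 := variance_eq_sub hsub
  have h2 : Var[fun y : ι → ℝ => c - ∑ i, a i * y i; P] = ∑ i, a i ^ 2 * v i := by
    rw [variance_const_sub hsum.aestronglyMeasurable, hvar]
  have h3 : ∫ y, (c - ∑ i, a i * y i) ∂P = c - ∑ i, a i * m i := by
    rw [integral_sub (integrable_const c) (hsum.integrable (by norm_num)), hmean]
    simp
  rw [h2, h3] at h1
  simp only [Pi.pow_apply] at h1
  linarith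

end Gaussian

/-! ### Bandwidth arithmetic. -/

section Bandwidth

variable {d n : ℕ} {β : ℝ}

lemma bandwidth_pos (hn : 1 ≤ n) : 0 < bandwidth β d n :=
  Real.rpow_pos_of_pos (by exact_mod_cast hn) _

lemma bandwidth_le_one (hβ : 0 < β) (hn : 1 ≤ n) : bandwidth β d n ≤ 1 :=
  Real.rpow_le_one_of_one_le_of_nonpos (by exact_mod_cast hn)
    (neg_nonpos.2 (by positivity))

lemma bandwidth_rpow (t : ℝ) :
    bandwidth β d n ^ t = (n : ℝ) ^ (-(t / (β + (d : ℝ)))) := by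
  rw [bandwidth, ← Real.rpow_mul (Nat.cast_nonneg n)]
  congr 1
  ring

/-- The balance equation that defines the bandwidth: it equates the standard deviation scale `(n
h^d)⁻¹` with the bias scale `h^β`. -/
lemma bandwidth_pow_mul (hβ : 0 < β) (hn : 1 ≤ n) :
    (n : ℝ) * bandwidth β d n ^ d = (bandwidth β d n ^ β)⁻¹ := by
  have hn0 : (0 : ℝ) < n := by exact_mod_cast hn
  have hs : (0 : ℝ) < β + d := by positivity
  rw [← Real.rpow_natCast (bandwidth β d n) d, bandwidth_rpow, bandwidth_rpow,
    ← Real.rpow_neg hn0.le]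
  nth_rewrite 1 [← Real.rpow_one (n : ℝ)]
  rw [← Real.rpow_add hn0]
  congr 1
  field_simp
  ring

lemma tendsto_bandwidth (hβ : 0 < β) :
    Tendsto (fun n : ℕ => bandwidth β d n) atTop (nhds 0) :=
  (tendsto_rpow_neg_atTop (show 0 < 1 / (β + (d : ℝ)) by positivity)).comp
    tendsto_natCast_atTop_atTop

/-- The ratio of the bandwidth to the mesh `n^(-1/d)` of a fixed design. By `root_exponent_pos` the
exponent is positive, so the mesh is negligible against the bandwidth. -/
lemma bandwidth_mul_root (hn : 1 ≤ n) :
    bandwidth β d n * (n : ℝ) ^ (1 / (d : ℝ)) = (n : ℝ) ^ (1 / (d : ℝ) - 1 / (β + d)) := by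
  have hn0 : (0 : ℝ) < n := by exact_mod_cast hn
  rw [bandwidth, ← Real.rpow_add hn0]
  congr 1
  ring

lemma root_exponent_pos (hd : 0 < d) (hβ : 0 < β) : 0 < 1 / (d : ℝ) - 1 / (β + d) := by
  have : (0 : ℝ) < d := by exact_mod_cast hd
  exact sub_pos.2 (one_div_lt_one_div_of_lt this (by linarith))

lemma root_pow (hd : 0 < d) (n : ℕ) : ((n : ℝ) ^ (1 / (d : ℝ))) ^ d = n := by
  rw [one_div]
  exact Real.rpow_inv_natCast_pow (Nat.cast_nonneg n) hd.ne'

end Bandwidth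

/-! ### Packing and covering counts of design points. -/

section Balls

variable {d : ℕ}

/-- The volume of the unit ball. -/
noncomputable def unitVol (d : ℕ) : ℝ := (volume : Measure (Space d)).real (Metric.ball 0 1)

lemma unitVol_pos (d : ℕ) : 0 < unitVol d :=
  ENNReal.toReal_pos (Metric.measure_ball_pos _ _ one_pos).ne' measure_ball_lt_top.ne

lemma volume_closedBall_eq (y : Space d) {r : ℝ} (hr : 0 ≤ r) :
    volume (Metric.closedBall y r) = ENNReal.ofReal (r ^ d * unitVol d) := by
  rw [Measure.addHaar_closedBall _ _ hr, finrank_euclideanSpace_fin,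
    ENNReal.ofReal_mul (by positivity), unitVol, Measure.real,
    ENNReal.ofReal_toReal measure_ball_lt_top.ne]

lemma volume_ball_eq (y : Space d) {r : ℝ} (hr : 0 < r) :
    volume (Metric.ball y r) = ENNReal.ofReal (r ^ d * unitVol d) := by
  rw [Measure.addHaar_ball_of_pos _ _ hr, finrank_euclideanSpace_fin,
    ENNReal.ofReal_mul (by positivity), unitVol, Measure.real,
    ENNReal.ofReal_toReal measure_ball_lt_top.ne]

/-- The points of `𝒳` within distance `ρ` of `y`. -/
def nearSet (𝒳 : Set (Space d)) (y : Space d) (ρ : ℝ) : Set 𝒳 :=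
  {z | ‖(z : Space d) - y‖ ≤ ρ}

lemma measurableSet_nearSet (𝒳 : Set (Space d)) (y : Space d) (ρ : ℝ) :
    MeasurableSet (nearSet 𝒳 y ρ) :=
  measurableSet_le (by fun_prop) measurable_const

open Classical in
/-- The design points within distance `ρ` of `y`. -/
noncomputable def nearIdx {𝒳 : Set (Space d)} {n : ℕ} (X : Fin n → 𝒳) (y : Space d) (ρ : ℝ) :
    Finset (Fin n) :=
  Finset.univ.filter fun i => X i ∈ nearSet 𝒳 y ρ

lemma mem_nearIdx {𝒳 : Set (Space d)} {n : ℕ} {X : Fin n → 𝒳} {y : Space d} {ρ : ℝ} {i : Fin n} :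
    i ∈ nearIdx X y ρ ↔ ‖(X i : Space d) - y‖ ≤ ρ := by
  classical
  simp only [nearIdx, Finset.mem_filter, Finset.mem_univ, true_and]
  rfl

lemma sum_indicator_nearSet {𝒳 : Set (Space d)} {n : ℕ} (X : Fin n → 𝒳) (y : Space d) (ρ : ℝ) :
    ∑ i, (nearSet 𝒳 y ρ).indicator (1 : 𝒳 → ℝ≥0∞) (X i) = (nearIdx X y ρ).card := by
  classical
  simp only [Set.indicator_apply, Pi.one_apply, nearIdx, Finset.sum_boole]

/-- Packing: the balls of radius `δ` around the counted points are disjoint and lie in the ball of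
radius `ρ + δ`. Volumes are compared in the ambient space, so the shape of `𝒳` is irrelevant. -/
lemma card_nearIdx_le {𝒳 : Set (Space d)} {n : ℕ} {X : Fin n → 𝒳} {δ : ℝ} (hδ : 0 < δ)
    (hX : ∀ i j, i ≠ j → 2 * δ ≤ ‖(X i : Space d) - (X j : Space d)‖) (y : Space d) {ρ : ℝ}
    (hρ : 0 ≤ ρ) : ((nearIdx X y ρ).card : ℝ) * δ ^ d ≤ (ρ + δ) ^ d := by
  have hdis : (nearIdx X y ρ : Set (Fin n)).PairwiseDisjoint
      fun i => Metric.ball (X i : Space d) δ := by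
    intro i _ j _ hij
    refine Metric.ball_disjoint_ball ?_
    rw [dist_eq_norm]
    linarith [hX i j hij]
  have hsub : (⋃ i ∈ nearIdx X y ρ, Metric.ball (X i : Space d) δ) ⊆
      Metric.closedBall y (ρ + δ) := by
    refine Set.iUnion₂_subset fun i hi z hz => ?_
    have h1 := mem_nearIdx.1 hi
    rw [Metric.mem_ball, dist_eq_norm] at hz
    rw [Metric.mem_closedBall, dist_eq_norm]
    have := norm_sub_le_norm_sub_add_norm_sub z (X i : Space d) y
    linarith
  have hvol := measure_mono (μ := volume) hsub
  rw [measure_biUnion_finset hdis fun i _ => Metric.isOpen_ball.measurableSet] at hvol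
  simp_rw [volume_ball_eq _ hδ] at hvol
  rw [volume_closedBall_eq _ (by positivity), Finset.sum_const, nsmul_eq_mul,
    ← ENNReal.ofReal_natCast, ← ENNReal.ofReal_mul (by positivity),
    ENNReal.ofReal_le_ofReal_iff (by have := unitVol_pos d; positivity), ← mul_assoc] at hvol
  exact le_of_mul_le_mul_right hvol (unitVol_pos d)

/-- Covering: the `δ`-balls around the design points within `ρ + δ` of `y` cover the part of `𝒳`
within `ρ` of `y`, so their total volume is at least `a`. -/
lemma le_card_nearIdx {𝒳 : Set (Space d)} {n : ℕ} {X : Fin n → 𝒳} {δ : ℝ} (hδ : 0 < δ)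
    (hX : ∀ z : 𝒳, ∃ j, ‖(z : Space d) - (X j : Space d)‖ ≤ δ) (y : Space d) {ρ a : ℝ}
    (ha : ENNReal.ofReal a ≤ volume (𝒳 ∩ Metric.closedBall y ρ)) :
    a ≤ ((nearIdx X y (ρ + δ)).card : ℝ) * (δ ^ d * unitVol d) := by
  have hsub : 𝒳 ∩ Metric.closedBall y ρ ⊆
      ⋃ i ∈ nearIdx X y (ρ + δ), Metric.closedBall (X i : Space d) δ := by
    rintro z ⟨hz, hzy⟩
    obtain ⟨j, hj⟩ := hX ⟨z, hz⟩
    rw [Metric.mem_closedBall, dist_eq_norm] at hzy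
    refine Set.mem_iUnion₂.2 ⟨j, mem_nearIdx.2 ?_, ?_⟩
    · have := norm_sub_le_norm_sub_add_norm_sub (X j : Space d) z y
      rw [norm_sub_rev (X j : Space d) z] at this
      simp only at hj
      linarith
    · rwa [Metric.mem_closedBall, dist_eq_norm]
  have hvol := (ha.trans (measure_mono hsub)).trans (measure_biUnion_finset_le _ _)
  simp_rw [volume_closedBall_eq _ hδ.le] at hvol
  have := unitVol_pos d
  rwa [Finset.sum_const, nsmul_eq_mul, ← ENNReal.ofReal_natCast,
    ← ENNReal.ofReal_mul (by positivity), ENNReal.ofReal_le_ofReal_iff (by positivity)] at hvol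

end Balls

/-! ### Fixed design: neighbour counts near the query points. -/

section FixedDesign

variable {d : ℕ} {𝒳 : Set (Space d)} {β : ℝ} {P : ∀ n : ℕ, Measure (Fin n → 𝒳)}

lemma IsFixedDesign.measure_few_near (hP : IsFixedDesign 𝒳 P) (hd : 0 < d) (hβ : 0 < β)
    {y : Space d} (hy : IsThickAt 𝒳 y) {ρ : ℝ} (hρ : 0 < ρ) :
    ∃ c C : ℝ, 0 < c ∧ 0 ≤ C ∧ ∀ᶠ n : ℕ in atTop,
      P n {X | ((nearIdx X y (ρ * bandwidth β d n)).card : ℝ) < c * (n * bandwidth β d n ^ d)} ≤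
        ENNReal.ofReal (C * bandwidth β d n ^ (2 * β)) := by
  obtain ⟨X, c, C, hc, hC, hX, hP⟩ := hP
  obtain ⟨κ, hκ, hthick⟩ := hy
  have hω := unitVol_pos d
  -- Half of the radius goes to the covered ball and the other half absorbs the mesh `C n^(-1/d)`.
  -- The exceptional constant is `0`: for large `n` the deterministic design is never sparse at `y`.
  refine ⟨κ * (ρ / 2) ^ d / (C ^ d * unitVol d), 0, by positivity, le_rfl, ?_⟩
  have hlim : Tendsto (fun n : ℕ => (n : ℝ) ^ (1 / (d : ℝ) - 1 / (β + d))) atTop atTop :=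
    (tendsto_rpow_atTop (root_exponent_pos hd hβ)).comp tendsto_natCast_atTop_atTop
  filter_upwards [eventually_ge_atTop 1, hlim.eventually_ge_atTop (2 * C / ρ),
    (tendsto_bandwidth (d := d) hβ).eventually_le_const (show (0 : ℝ) < 2 / ρ by positivity)]
    with n hn h1 h2
  have hn0 : (0 : ℝ) < n := by exact_mod_cast hn
  set h := bandwidth β d n with hh
  have hh0 : 0 < h := bandwidth_pos hn
  set s := (n : ℝ) ^ (1 / (d : ℝ)) with hs
  have hs0 : 0 < s := Real.rpow_pos_of_pos hn0 _
  rw [← bandwidth_mul_root hn, ← hh, ← hs, div_le_iff₀ hρ] at h1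
  rw [le_div_iff₀ hρ] at h2
  have hδ : C / s ≤ ρ / 2 * h := by
    rw [div_le_iff₀ hs0]
    linarith
  have key := le_card_nearIdx (X := X n) (δ := C / s) (by positivity) (hX n hn).2 y
    (hthick (ρ / 2 * h) (by positivity) (by linarith))
  have hmono : (nearIdx (X n) y (ρ / 2 * h + C / s)).card ≤ (nearIdx (X n) y (ρ * h)).card := by
    refine Finset.card_le_card fun i hi => mem_nearIdx.2 ((mem_nearIdx.1 hi).trans ?_)
    linarith
  have hmono' : ((nearIdx (X n) y (ρ / 2 * h + C / s)).card : ℝ) ≤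
      (nearIdx (X n) y (ρ * h)).card := by exact_mod_cast hmono
  rw [hP n]
  refine le_of_eq_of_le ?_ zero_le
  rw [Measure.dirac_apply, Set.indicator_of_notMem]
  rw [Set.mem_ofPred_eq, not_lt, div_mul_eq_mul_div, div_le_iff₀ (by positivity)]
  have hpow : (C / s) ^ d = C ^ d / n := by rw [div_pow, root_pow hd]
  rw [hpow] at key
  have key2 : κ * (ρ / 2 * h) ^ d ≤
      ((nearIdx (X n) y (ρ * h)).card : ℝ) * (C ^ d / n * unitVol d) := by
    refine key.trans ?_
    gcongr
  calc κ * (ρ / 2) ^ d * (n * h ^ d) = κ * (ρ / 2 * h) ^ d * n := by rw [mul_pow]; ring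
    _ ≤ ((nearIdx (X n) y (ρ * h)).card : ℝ) * (C ^ d / n * unitVol d) * n := by gcongr
    _ = _ := by field_simp

lemma IsFixedDesign.lintegral_near_pairs (hP : IsFixedDesign 𝒳 P) (hd : 0 < d) (hβ : 0 < β)
    (y y' : Space d) :
    ∃ C : ℝ, 0 ≤ C ∧ ∀ᶠ n : ℕ in atTop,
      ∫⁻ X, ∑ p : Link n, (nearSet 𝒳 y (bandwidth β d n)).indicator (1 : 𝒳 → ℝ≥0∞) (X p.1.1) *
          (nearSet 𝒳 y' (bandwidth β d n)).indicator (1 : 𝒳 → ℝ≥0∞) (X p.1.2) ∂(P n) ≤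
        ENNReal.ofReal (C * (n * bandwidth β d n ^ d) ^ 2) := by
  obtain ⟨X, c, C, hc, hC, hX, hP⟩ := hP
  set M := ((1 + c / 2) / (c / 2)) ^ d with hM
  refine ⟨M ^ 2, by positivity, ?_⟩
  filter_upwards [eventually_ge_atTop 1] with n hn
  have hn0 : (0 : ℝ) < n := by exact_mod_cast hn
  set h := bandwidth β d n with hh
  have hh0 : 0 < h := bandwidth_pos hn
  set s := (n : ℝ) ^ (1 / (d : ℝ)) with hs
  have hs0 : 0 < s := Real.rpow_pos_of_pos hn0 _
  have h1 : 1 ≤ h * s := by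
    rw [hh, hs, bandwidth_mul_root hn]
    exact Real.one_le_rpow (by exact_mod_cast hn) (root_exponent_pos hd hβ).le
  have hcard : ∀ z : Space d, ((nearIdx (X n) z h).card : ℝ) ≤ M * (n * h ^ d) := by
    intro z
    have key := card_nearIdx_le (X := X n) (δ := c / 2 / s) (by positivity)
      (fun i j hij => le_of_eq_of_le (by ring) ((hX n hn).1 i j hij)) z hh0.le
    -- The mesh is at most the bandwidth, so enlarging the radius from `h` to `h + δ` in the packing
    -- bound costs only a constant factor.
    have h2 : c / 2 / s ≤ c / 2 * h := by
      rw [div_le_iff₀ hs0, mul_assoc]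
      exact le_mul_of_one_le_right (by positivity) h1
    have h3 : (h + c / 2 / s) ^ d ≤ ((1 + c / 2) * h) ^ d := by
      gcongr
      linarith
    rw [div_pow, root_pow hd] at key
    rw [mul_pow] at h3
    rw [hM, div_pow, div_mul_eq_mul_div, le_div_iff₀ (by positivity)]
    calc ((nearIdx (X n) z h).card : ℝ) * (c / 2) ^ d
        = ((nearIdx (X n) z h).card : ℝ) * ((c / 2) ^ d / n) * n := by field_simp
      _ ≤ ((1 + c / 2) ^ d * h ^ d) * n := by
          exact mul_le_mul_of_nonneg_right (key.trans h3) hn0.le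
      _ = _ := by ring
  rw [hP n, lintegral_dirac]
  calc ∑ p : Link n, (nearSet 𝒳 y h).indicator (1 : 𝒳 → ℝ≥0∞) (X n p.1.1) *
        (nearSet 𝒳 y' h).indicator (1 : 𝒳 → ℝ≥0∞) (X n p.1.2)
      ≤ ∑ p : Fin n × Fin n, (nearSet 𝒳 y h).indicator (1 : 𝒳 → ℝ≥0∞) (X n p.1) *
        (nearSet 𝒳 y' h).indicator (1 : 𝒳 → ℝ≥0∞) (X n p.2) := by
        rw [← Finset.sum_subtype (Finset.univ.filter fun p : Fin n × Fin n => p.1 < p.2)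
          (by simp) fun p => (nearSet 𝒳 y h).indicator (1 : 𝒳 → ℝ≥0∞) (X n p.1) *
            (nearSet 𝒳 y' h).indicator (1 : 𝒳 → ℝ≥0∞) (X n p.2)]
        exact Finset.sum_le_sum_of_subset (Finset.filter_subset _ _)
    _ = (nearIdx (X n) y h).card * (nearIdx (X n) y' h).card := by
        rw [← sum_indicator_nearSet, ← sum_indicator_nearSet, Finset.sum_mul_sum,
          Fintype.sum_prod_type]
    _ ≤ _ := by
        rw [← Nat.cast_mul, ← ENNReal.ofReal_natCast]
        refine ENNReal.ofReal_le_ofReal ?_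
        push_cast
        calc _ ≤ (M * (n * h ^ d)) * (M * (n * h ^ d)) := by
              gcongr <;> exact hcard _
          _ = _ := by ring

end FixedDesign

/-! ### Random design: a Chernoff bound and expected pair counts. -/

section RandomDesign

/-- Chernoff's method with exponent `1`: since `exp (-1) ≤ 1/2`, each factor satisfies `E exp (-1_B)
≤ 1 - μ(B)/2 ≤ exp (-p/2)`. Markov's inequality then gives `exp (n p/4) exp (-n p/2)`. -/
lemma pi_measure_few_le {α : Type*} [MeasurableSpace α] (μ : Measure α) [IsProbabilityMeasure μ]
    {B : Set α} (hB : MeasurableSet B) {p : ℝ} (hp : 0 ≤ p) (hpB : ENNReal.ofReal p ≤ μ B) (n : ℕ)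
    (N : (Fin n → α) → ℝ) (hN : ∀ X, N X = ∑ i, B.indicator (1 : α → ℝ) (X i)) :
    (Measure.pi fun _ : Fin n => μ) {X | N X < n * p / 4} ≤
      ENNReal.ofReal (Real.exp (-(n * p / 4))) := by
  let f : α → ℝ≥0∞ := fun z => ENNReal.ofReal (Real.exp (-(B.indicator (1 : α → ℝ) z)))
  have hf : Measurable f := by
    have : Measurable (B.indicator (1 : α → ℝ)) := measurable_one.indicator hB
    fun_prop
  have hfint : ∫⁻ z, f z ∂μ ≤ ENNReal.ofReal (Real.exp (-(p / 2))) := by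
    have h1 : f = fun z => B.indicator (fun _ => ENNReal.ofReal (Real.exp (-1))) z +
        Bᶜ.indicator (fun _ => 1) z := by
      ext z
      by_cases hz : z ∈ B <;> simp [f, hz]
    have h2 : μ B = ENNReal.ofReal (μ.real B) := by simp [Measure.real]
    have h3 : μ Bᶜ = ENNReal.ofReal (1 - μ.real B) := by
      rw [← probReal_compl_eq_one_sub hB]
      simp [Measure.real]
    have h4 : p ≤ μ.real B := by
      rwa [h2, ENNReal.ofReal_le_ofReal_iff measureReal_nonneg] at hpB
    have h5 : μ.real B ≤ 1 := measureReal_le_one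
    rw [h1, lintegral_add_left (measurable_const.indicator hB), lintegral_indicator_const hB,
      lintegral_indicator_const hB.compl, h2, h3, ← ENNReal.ofReal_mul (Real.exp_pos _).le, one_mul,
      ← ENNReal.ofReal_add (by positivity) (by linarith)]
    refine ENNReal.ofReal_le_ofReal ?_
    have h6 : Real.exp (-1) ≤ 1 / 2 := by
      rw [Real.exp_neg, inv_eq_one_div]
      exact one_div_le_one_div_of_le (by norm_num) (by linarith [Real.add_one_le_exp 1])
    have h7 := Real.add_one_le_exp (-(p / 2))
    nlinarith [measureReal_nonneg (μ := μ) (s := B)]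
  have hprod : ∀ X : Fin n → α, ENNReal.ofReal (Real.exp (-N X)) = ∏ i, f (X i) := by
    intro X
    rw [hN, ← Finset.sum_neg_distrib, Real.exp_sum,
      ENNReal.ofReal_prod_of_nonneg fun i _ => (Real.exp_pos _).le]
  have hm : Measurable fun X : Fin n → α => ∏ i, f (X i) :=
    Finset.measurable_prod _ fun i _ => hf.comp (measurable_pi_apply i)
  calc (Measure.pi fun _ : Fin n => μ) {X | N X < n * p / 4}
      ≤ ∫⁻ X, ENNReal.ofReal (Real.exp (n * p / 4)) * ∏ i, f (X i)
          ∂(Measure.pi fun _ : Fin n => μ) := by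
        refine meas_le_lintegral₀ (hm.const_mul _).aemeasurable fun X hX => ?_
        rw [← hprod, ← ENNReal.ofReal_mul (Real.exp_pos _).le, ← Real.exp_add,
          ENNReal.one_le_ofReal]
        exact Real.one_le_exp (by linarith [Set.mem_ofPred_eq ▸ hX])
    _ = ENNReal.ofReal (Real.exp (n * p / 4)) * (∫⁻ z, f z ∂μ) ^ n := by
        rw [lintegral_const_mul _ hm, lintegral_pi_prod (fun _ => μ) (fun _ => f) fun _ => hf]
        simp
    _ ≤ ENNReal.ofReal (Real.exp (n * p / 4)) * ENNReal.ofReal (Real.exp (-(p / 2))) ^ n := by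
        gcongr
    _ = _ := by
        rw [← ENNReal.ofReal_pow (Real.exp_pos _).le, ← ENNReal.ofReal_mul (Real.exp_pos _).le,
          ← Real.exp_nat_mul, ← Real.exp_add]
        congr 2
        ring

variable {d : ℕ} {𝒳 : Set (Space d)} {β : ℝ} {P : ∀ n : ℕ, Measure (Fin n → 𝒳)}

/-- The law of one covariate in a random design. -/
lemma IsRandomDesign.exists_law (hP : IsRandomDesign 𝒳 P) (h𝒳 : MeasurableSet 𝒳) :
    ∃ (μ : Measure 𝒳) (l u : ℝ), IsProbabilityMeasure μ ∧ 0 < l ∧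
      (∀ (y : Space d) (r : ℝ), ENNReal.ofReal l * volume (𝒳 ∩ Metric.closedBall y r) ≤
        μ (nearSet 𝒳 y r)) ∧
      (∀ (y : Space d) (r : ℝ), μ (nearSet 𝒳 y r) ≤
        ENNReal.ofReal u * volume (Metric.closedBall y r)) ∧
      ∀ n, P n = Measure.pi fun _ : Fin n => μ := by
  obtain ⟨m, l, u, hm, hl, hb, hint, hP⟩ := hP
  have hvol : ∀ (y : Space d) (r : ℝ), (Measure.comap Subtype.val (volume : Measure (Space d)))
      (nearSet 𝒳 y r) = volume (𝒳 ∩ Metric.closedBall y r) := by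
    intro y r
    rw [(MeasurableEmbedding.subtype_coe h𝒳).comap_apply]
    congr 1
    rw [← Subtype.image_preimage_coe]
    congr 1
  refine ⟨_, l, u, ⟨?_⟩, hl, fun y r => ?_, fun y r => ?_, hP⟩
  · rw [withDensity_apply _ MeasurableSet.univ, Measure.restrict_univ, hint]
  · rw [withDensity_apply _ (measurableSet_nearSet _ _ _), ← hvol, ← setLIntegral_const]
    exact lintegral_mono fun z => ENNReal.ofReal_le_ofReal (hb z).1
  · rw [withDensity_apply _ (measurableSet_nearSet _ _ _)]
    calc _ ≤ ∫⁻ _ in nearSet 𝒳 y r, ENNReal.ofReal u ∂(Measure.comap Subtype.val volume) :=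
          lintegral_mono fun z => ENNReal.ofReal_le_ofReal (hb z).2
      _ ≤ _ := by
          rw [setLIntegral_const, hvol]
          gcongr
          exact Set.inter_subset_right

lemma IsRandomDesign.measure_few_near (hP : IsRandomDesign 𝒳 P) (h𝒳 : MeasurableSet 𝒳)
    (hβ : 0 < β) {y : Space d} (hy : IsThickAt 𝒳 y) {ρ : ℝ} (hρ : 0 < ρ) :
    ∃ c C : ℝ, 0 < c ∧ 0 ≤ C ∧ ∀ᶠ n : ℕ in atTop,
      P n {X | ((nearIdx X y (ρ * bandwidth β d n)).card : ℝ) < c * (n * bandwidth β d n ^ d)} ≤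
        ENNReal.ofReal (C * bandwidth β d n ^ (2 * β)) := by
  obtain ⟨μ, l, u, hμ, hl, hlow, -, hP⟩ := hP.exists_law h𝒳
  obtain ⟨κ, hκ, hthick⟩ := hy
  set c := l * κ * ρ ^ d / 4 with hc
  have hc0 : 0 < c := by positivity
  refine ⟨c, 2 / c ^ 2, hc0, by positivity, ?_⟩
  filter_upwards [eventually_ge_atTop 1,
    (tendsto_bandwidth (d := d) hβ).eventually_le_const (show (0 : ℝ) < 1 / ρ by positivity)]
    with n hn h1
  have hn0 : (0 : ℝ) < n := by exact_mod_cast hn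
  have hq := bandwidth_pow_mul (d := d) hβ hn
  set h := bandwidth β d n with hh
  have hh0 : 0 < h := bandwidth_pos hn
  rw [le_div_iff₀ hρ] at h1
  have hB := (mul_le_mul_right (hthick (ρ * h) (by positivity) (by linarith))
    (ENNReal.ofReal l)).trans (hlow y (ρ * h))
  rw [← ENNReal.ofReal_mul hl.le] at hB
  have key := pi_measure_few_le μ (measurableSet_nearSet 𝒳 y (ρ * h)) (by positivity) hB n
    (fun X => (nearIdx X y (ρ * h)).card) fun X => by
      classical
      simp only [Set.indicator_apply, Pi.one_apply, nearIdx, Finset.sum_boole]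
  have he : (n : ℝ) * (l * (κ * (ρ * h) ^ d)) / 4 = c * (n * h ^ d) := by
    rw [hc, mul_pow]
    ring
  rw [he] at key
  rw [hP n]
  refine key.trans (ENNReal.ofReal_le_ofReal ?_)
  set t := c * (n * h ^ d) with ht
  have ht0 : 0 < t := by positivity
  -- By the balance equation the target `h^(2β)` is `(n h^d)^(-2)`, so `exp (-t) ≤ 2 / t²` is all
  -- that is needed from the exponential tail.
  have h2 : 2 / c ^ 2 * h ^ (2 * β) = 2 / t ^ 2 := by
    rw [ht, hq, mul_comm 2 β, Real.rpow_mul hh0.le, Real.rpow_ofNat]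
    have : 0 < h ^ β := by positivity
    field_simp
  rw [h2, Real.exp_neg, inv_eq_one_div, div_le_div_iff₀ (Real.exp_pos _) (by positivity)]
  linarith [Real.quadratic_le_exp_of_nonneg ht0.le]

/-- The two ends of a link are distinct indices, hence independent covariates, so each of the at
most `n²` links contributes `O(h^(2d))`. -/
lemma IsRandomDesign.lintegral_near_pairs (hP : IsRandomDesign 𝒳 P) (h𝒳 : MeasurableSet 𝒳)
    (y y' : Space d) :
    ∃ C : ℝ, 0 ≤ C ∧ ∀ᶠ n : ℕ in atTop,
      ∫⁻ X, ∑ p : Link n, (nearSet 𝒳 y (bandwidth β d n)).indicator (1 : 𝒳 → ℝ≥0∞) (X p.1.1) *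
          (nearSet 𝒳 y' (bandwidth β d n)).indicator (1 : 𝒳 → ℝ≥0∞) (X p.1.2) ∂(P n) ≤
        ENNReal.ofReal (C * (n * bandwidth β d n ^ d) ^ 2) := by
  obtain ⟨μ, l, u, hμ, hl, -, hup, hP⟩ := hP.exists_law h𝒳
  -- The absolute value avoids deriving the sign of `u` from the density bounds.
  set M := |u| * unitVol d with hM
  refine ⟨M ^ 2, by positivity, ?_⟩
  filter_upwards [eventually_ge_atTop 1] with n hn
  have hn0 : (0 : ℝ) < n := by exact_mod_cast hn
  set h := bandwidth β d n with hh
  have hh0 : 0 < h := bandwidth_pos hn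
  have hω := unitVol_pos d
  have hA : ∀ z : Space d, μ (nearSet 𝒳 z h) ≤ ENNReal.ofReal (M * h ^ d) := by
    intro z
    refine (hup z h).trans ?_
    rw [volume_closedBall_eq _ hh0.le]
    calc _ ≤ ENNReal.ofReal |u| * ENNReal.ofReal (h ^ d * unitVol d) := by
          gcongr
          exact le_abs_self u
      _ = _ := by
          rw [← ENNReal.ofReal_mul (abs_nonneg u)]
          congr 1
          ring
  have hm : ∀ z : Space d, Measurable ((nearSet 𝒳 z h).indicator (1 : 𝒳 → ℝ≥0∞)) := fun z =>
    measurable_one.indicator (measurableSet_nearSet _ _ _)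
  have hm' : ∀ (z : Space d) (i : Fin n),
      Measurable fun X : Fin n → 𝒳 => (nearSet 𝒳 z h).indicator (1 : 𝒳 → ℝ≥0∞) (X i) :=
    fun z i => (hm z).comp (measurable_pi_apply i)
  have hone : ∀ p : Link n, ∫⁻ X, (nearSet 𝒳 y h).indicator (1 : 𝒳 → ℝ≥0∞) (X p.1.1) *
      (nearSet 𝒳 y' h).indicator (1 : 𝒳 → ℝ≥0∞) (X p.1.2) ∂(P n) ≤
        ENNReal.ofReal ((M * h ^ d) ^ 2) := by
    intro p
    have hind : IndepFun (fun X : Fin n → 𝒳 => (nearSet 𝒳 y h).indicator (1 : 𝒳 → ℝ≥0∞) (X p.1.1))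
        (fun X : Fin n → 𝒳 => (nearSet 𝒳 y' h).indicator (1 : 𝒳 → ℝ≥0∞) (X p.1.2))
        (Measure.pi fun _ : Fin n => μ) :=
      ((iIndepFun_pi (μ := fun _ : Fin n => μ) (X := fun _ z => z)
        fun _ => aemeasurable_id).indepFun p.2.ne).comp (hm y) (hm y')
    rw [hP n, lintegral_mul_eq_lintegral_mul_lintegral_of_indepFun''
      (hm' y p.1.1).aemeasurable (hm' y' p.1.2).aemeasurable hind,
      (measurePreserving_eval (fun _ : Fin n => μ) p.1.1).lintegral_comp (hm y),
      (measurePreserving_eval (fun _ : Fin n => μ) p.1.2).lintegral_comp (hm y'),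
      lintegral_indicator_one (measurableSet_nearSet _ _ _),
      lintegral_indicator_one (measurableSet_nearSet _ _ _), sq, ENNReal.ofReal_mul (by positivity)]
    exact mul_le_mul' (hA y) (hA y')
  have hcard : (Fintype.card (Link n) : ℝ) ≤ n ^ 2 := by
    have := Fintype.card_subtype_le (fun p : Fin n × Fin n => p.1 < p.2)
    rw [Fintype.card_prod, Fintype.card_fin, ← sq] at this
    exact_mod_cast this
  rw [lintegral_finsetSum _ fun p _ => (hm' y p.1.1).mul (hm' y' p.1.2)]
  calc _ ≤ ∑ _p : Link n, ENNReal.ofReal ((M * h ^ d) ^ 2) := Finset.sum_le_sum fun p _ => hone p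
    _ = ENNReal.ofReal (Fintype.card (Link n) * (M * h ^ d) ^ 2) := by
        rw [Finset.sum_const, nsmul_eq_mul, Finset.card_univ, ENNReal.ofReal_mul (by positivity),
          ENNReal.ofReal_natCast]
    _ ≤ _ := by
        refine ENNReal.ofReal_le_ofReal ?_
        calc _ ≤ (n : ℝ) ^ 2 * (M * h ^ d) ^ 2 := by gcongr
          _ = _ := by ring

end RandomDesign

/-! ### Ordered pairs versus links. -/

section Links

variable {n : ℕ}

lemma sum_offDiag_eq_sum_links (F : Fin n → Fin n → ℝ) :
    ∑ p ∈ Finset.univ.filter (fun p : Fin n × Fin n => p.1 ≠ p.2), F p.1 p.2 =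
      ∑ p : Link n, (F p.1.1 p.1.2 + F p.1.2 p.1.1) := by
  have h1 : Finset.univ.filter (fun p : Fin n × Fin n => p.1 ≠ p.2) =
      Finset.univ.filter (fun p : Fin n × Fin n => p.1 < p.2) ∪
        Finset.univ.filter (fun p : Fin n × Fin n => p.2 < p.1) := by
    ext p
    simp [lt_or_lt_iff_ne]
  have h2 : Disjoint (Finset.univ.filter (fun p : Fin n × Fin n => p.1 < p.2))
      (Finset.univ.filter (fun p : Fin n × Fin n => p.2 < p.1)) :=
    Finset.disjoint_filter.2 fun p _ h h' => lt_asymm h h'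
  have h3 : ∑ p ∈ Finset.univ.filter (fun p : Fin n × Fin n => p.2 < p.1), F p.1 p.2 =
      ∑ p ∈ Finset.univ.filter (fun p : Fin n × Fin n => p.1 < p.2), F p.2 p.1 :=
    Finset.sum_nbij' Prod.swap Prod.swap (by simp) (by simp) (by simp) (by simp) (by simp)
  rw [h1, Finset.sum_union h2, h3, ← Finset.sum_add_distrib]
  exact Finset.sum_subtype _ (by simp) fun p : Fin n × Fin n => F p.1 p.2 + F p.2 p.1

lemma outcome_link (Y : Link n → ℝ) (p : Link n) : outcome Y p.1.1 p.1.2 = Y p := by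
  simp [outcome, p.2]

lemma outcome_link_swap (Y : Link n → ℝ) (p : Link n) : outcome Y p.1.2 p.1.1 = Y p := by
  simp [outcome, p.2, p.2.le]

end Links

/-! ### The smoother as a weighted average: bias, variance and total weight. -/

section Smoother

variable {d n : ℕ} {𝒳 : Set (Space d)}

/-- The weight of the ordered pair `(i, j)` in the kernel smoother. -/
noncomputable def pairWeight (K : Space d → ℝ) (h lam : ℝ) (x x' : 𝒳) (X : Fin n → 𝒳)
    (i j : Fin n) : ℝ :=
  scaledKernel K h ((x : Space d) - (X i : Space d)) *
    scaledKernel K h ((x' : Space d) - (X j : Space d)) + lam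

/-- The total weight in the kernel smoother. -/
noncomputable def totalWeight (K : Space d → ℝ) (h lam : ℝ) (x x' : 𝒳) (X : Fin n → 𝒳) : ℝ :=
  ∑ p ∈ Finset.univ.filter (fun p : Fin n × Fin n => p.1 ≠ p.2),
    pairWeight K h lam x x' X p.1 p.2

/-- The normalized weight of a link in the kernel smoother. -/
noncomputable def linkWeight (K : Space d → ℝ) (h lam : ℝ) (x x' : 𝒳) (X : Fin n → 𝒳)
    (p : Link n) : ℝ :=
  (pairWeight K h lam x x' X p.1.1 p.1.2 + pairWeight K h lam x x' X p.1.2 p.1.1) /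
    totalWeight K h lam x x' X

lemma offDiag_nonempty (hn : 2 ≤ n) :
    (Finset.univ.filter (fun p : Fin n × Fin n => p.1 ≠ p.2)).Nonempty :=
  ⟨(⟨0, by omega⟩, ⟨1, by omega⟩), by simp⟩

/-- The two orderings of a link share one outcome. Merging them leaves independent summands, so the
Gaussian risk formula applies. With `n ≥ 2` the normalizing cardinality is nonzero and cancels. -/
lemma kernelSmoother_eq (K : Space d → ℝ) (h lam : ℝ) (x x' : 𝒳) (hn : 2 ≤ n)
    (X : Fin n → 𝒳) (Y : Link n → ℝ) :
    kernelSmoother K h lam x x' n (X, Y) = ∑ p, linkWeight K h lam x x' X p * Y p := by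
  have hc : ((Finset.univ.filter (fun p : Fin n × Fin n => p.1 ≠ p.2)).card : ℝ)⁻¹ ≠ 0 :=
    inv_ne_zero (by exact_mod_cast (Finset.card_pos.2 (offDiag_nonempty hn)).ne')
  simp only [kernelSmoother]
  rw [mul_div_mul_left _ _ hc]
  have h1 := sum_offDiag_eq_sum_links
    (fun i j => outcome Y i j * pairWeight K h lam x x' X i j)
  simp only [pairWeight] at h1
  rw [h1, Finset.sum_div]
  refine Finset.sum_congr rfl fun p _ => ?_
  rw [outcome_link, outcome_link_swap]
  simp only [linkWeight, totalWeight, pairWeight]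
  ring

lemma measurable_scaledKernel {K : Space d → ℝ} (hK : Measurable K) (h : ℝ) :
    Measurable (scaledKernel K h) :=
  (hK.comp (measurable_const_smul h⁻¹)).const_mul _

lemma measurable_outcome (i j : Fin n) : Measurable fun Y : Link n → ℝ => outcome Y i j := by
  unfold outcome
  split_ifs <;> fun_prop

lemma measurable_kernelSmoother {K : Space d → ℝ} (hK : Measurable K) (h lam : ℝ) (x x' : 𝒳) :
    Measurable (kernelSmoother K h lam x x' n) := by
  have hw : ∀ p : Fin n × Fin n, Measurable fun D : (Fin n → 𝒳) × (Link n → ℝ) =>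
      scaledKernel K h ((x : Space d) - (D.1 p.1 : Space d)) *
        scaledKernel K h ((x' : Space d) - (D.1 p.2 : Space d)) + lam := fun p =>
    (((measurable_scaledKernel hK h).comp (by fun_prop)).mul
      ((measurable_scaledKernel hK h).comp (by fun_prop))).add_const _
  refine Measurable.div ?_ ?_
  · exact (Finset.measurable_sum _ fun p _ =>
      ((measurable_outcome p.1 p.2).comp measurable_snd).mul (hw p)).const_mul _
  · exact (Finset.measurable_sum _ fun p _ => hw p).const_mul _

lemma lintegral_smoother (K : Space d → ℝ) (h lam : ℝ) (x x' : 𝒳) (hn : 2 ≤ n)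
    (X : Fin n → 𝒳) (f : 𝒳 → 𝒳 → ℝ) (v : 𝒳 → 𝒳 → ℝ≥0) :
    ∫⁻ Y, ENNReal.ofReal ((f x x' - kernelSmoother K h lam x x' n (X, Y)) ^ 2)
        ∂(outcomeLaw f v X) =
      ENNReal.ofReal ((f x x' - ∑ p, linkWeight K h lam x x' X p * f (X p.1.1) (X p.1.2)) ^ 2 +
        ∑ p, linkWeight K h lam x x' X p ^ 2 * v (X p.1.1) (X p.1.2)) := by
  simp_rw [kernelSmoother_eq K h lam x x' hn]
  exact lintegral_sq_sub_linear _ _ _ _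

variable {K : Space d → ℝ} {h lam : ℝ} {x x' : 𝒳}

lemma scaledKernel_nonneg (hK : ∀ z, 0 ≤ K z) (hh : 0 < h) (z : Space d) :
    0 ≤ scaledKernel K h z := mul_nonneg (by positivity) (hK _)

lemma pairWeight_pos (hK : ∀ z, 0 ≤ K z) (hh : 0 < h) (hlam : 0 < lam) (X : Fin n → 𝒳)
    (i j : Fin n) : 0 < pairWeight K h lam x x' X i j :=
  add_pos_of_nonneg_of_pos
    (mul_nonneg (scaledKernel_nonneg hK hh _) (scaledKernel_nonneg hK hh _)) hlam

lemma totalWeight_pos (hK : ∀ z, 0 ≤ K z) (hh : 0 < h) (hlam : 0 < lam) (hn : 2 ≤ n)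
    (X : Fin n → 𝒳) : 0 < totalWeight K h lam x x' X :=
  Finset.sum_pos (fun _ _ => pairWeight_pos hK hh hlam X _ _) (offDiag_nonempty hn)

lemma linkWeight_nonneg (hK : ∀ z, 0 ≤ K z) (hh : 0 < h) (hlam : 0 < lam) (hn : 2 ≤ n)
    (X : Fin n → 𝒳) (p : Link n) : 0 ≤ linkWeight K h lam x x' X p :=
  div_nonneg (add_pos (pairWeight_pos hK hh hlam X _ _) (pairWeight_pos hK hh hlam X _ _)).le
    (totalWeight_pos hK hh hlam hn X).le

lemma sum_linkWeight_mul (X : Fin n → 𝒳) (g : Fin n → Fin n → ℝ) (hg : ∀ i j, g i j = g j i) :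
    ∑ p : Link n, linkWeight K h lam x x' X p * g p.1.1 p.1.2 =
      (∑ p ∈ Finset.univ.filter (fun p : Fin n × Fin n => p.1 ≠ p.2),
        pairWeight K h lam x x' X p.1 p.2 * g p.1 p.2) / totalWeight K h lam x x' X := by
  rw [sum_offDiag_eq_sum_links (fun i j => pairWeight K h lam x x' X i j * g i j), Finset.sum_div]
  refine Finset.sum_congr rfl fun p _ => ?_
  rw [hg p.1.2 p.1.1, linkWeight]
  ring

lemma sum_linkWeight (hK : ∀ z, 0 ≤ K z) (hh : 0 < h) (hlam : 0 < lam) (hn : 2 ≤ n)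
    (X : Fin n → 𝒳) : ∑ p : Link n, linkWeight K h lam x x' X p = 1 := by
  have := sum_linkWeight_mul (K := K) (h := h) (lam := lam) (x := x) (x' := x') X
    (fun _ _ => 1) fun _ _ => rfl
  simp only [mul_one] at this
  rw [this]
  exact div_self (totalWeight_pos hK hh hlam hn X).ne'

lemma abs_bias_le (hK : ∀ z, 0 ≤ K z) (hh : 0 < h) (hlam : 0 < lam) (hn : 2 ≤ n)
    (X : Fin n → 𝒳) {f : 𝒳 → 𝒳 → ℝ} (hf : ∀ a b, f a b = f b a) :
    |f x x' - ∑ p, linkWeight K h lam x x' X p * f (X p.1.1) (X p.1.2)| ≤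
      (∑ p ∈ Finset.univ.filter (fun p : Fin n × Fin n => p.1 ≠ p.2),
        pairWeight K h lam x x' X p.1 p.2 * |f x x' - f (X p.1) (X p.2)|) /
          totalWeight K h lam x x' X := by
  rw [← sum_linkWeight_mul X (fun i j => |f x x' - f (X i) (X j)|)
    fun i j => by rw [hf (X i)]]
  have h1 : f x x' - ∑ p, linkWeight K h lam x x' X p * f (X p.1.1) (X p.1.2) =
      ∑ p, linkWeight K h lam x x' X p * (f x x' - f (X p.1.1) (X p.1.2)) := by
    simp_rw [mul_sub]
    rw [Finset.sum_sub_distrib, ← Finset.sum_mul, sum_linkWeight hK hh hlam hn, one_mul]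
  rw [h1]
  refine (Finset.abs_sum_le_sum_abs _ _).trans (le_of_eq (Finset.sum_congr rfl fun p _ => ?_))
  rw [abs_mul, abs_of_nonneg (linkWeight_nonneg hK hh hlam hn X p)]

/-- The conditional variance is at most the largest link weight times the noise level. -/
lemma variance_le (hK : ∀ z, 0 ≤ K z) (hh : 0 < h) (hlam : 0 < lam) (hn : 2 ≤ n)
    (X : Fin n → 𝒳) {v : 𝒳 → 𝒳 → ℝ≥0} {τ : ℝ≥0} (hv : ∀ a b, v a b ≤ τ) {M : ℝ}
    (hM : ∀ p, linkWeight K h lam x x' X p ≤ M) :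
    ∑ p, linkWeight K h lam x x' X p ^ 2 * v (X p.1.1) (X p.1.2) ≤ M * τ := by
  calc ∑ p, linkWeight K h lam x x' X p ^ 2 * v (X p.1.1) (X p.1.2)
      ≤ ∑ p, linkWeight K h lam x x' X p * (M * τ) := by
        refine Finset.sum_le_sum fun p _ => ?_
        have h0 := linkWeight_nonneg (x := x) (x' := x') hK hh hlam hn X p
        have h1 : (v (X p.1.1) (X p.1.2) : ℝ) ≤ τ := by exact_mod_cast hv _ _
        rw [sq, mul_assoc]
        exact mul_le_mul_of_nonneg_left
          (mul_le_mul (hM p) h1 (NNReal.coe_nonneg _) (h0.trans (hM p))) h0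
    _ = M * τ := by rw [← Finset.sum_mul, sum_linkWeight hK hh hlam hn, one_mul]

lemma linkWeight_le_one (hK : ∀ z, 0 ≤ K z) (hh : 0 < h) (hlam : 0 < lam) (hn : 2 ≤ n)
    (X : Fin n → 𝒳) (p : Link n) : linkWeight K h lam x x' X p ≤ 1 := by
  rw [← sum_linkWeight (x := x) (x' := x') hK hh hlam hn X]
  exact Finset.single_le_sum (fun q _ => linkWeight_nonneg hK hh hlam hn X q) (Finset.mem_univ p)

/-- The conditional risk is bounded whatever the design. -/
lemma conditional_risk_le_crude (hK : ∀ z, 0 ≤ K z) (hh : 0 < h) (hlam : 0 < lam) (hn : 2 ≤ n)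
    (X : Fin n → 𝒳) {β L : ℝ} {f : 𝒳 → 𝒳 → ℝ} (hf : f ∈ holderClass 𝒳 β L)
    {v : 𝒳 → 𝒳 → ℝ≥0} {τ : ℝ≥0} (hv : ∀ a b, v a b ≤ τ) :
    (f x x' - ∑ p, linkWeight K h lam x x' X p * f (X p.1.1) (X p.1.2)) ^ 2 +
        ∑ p, linkWeight K h lam x x' X p ^ 2 * v (X p.1.1) (X p.1.2) ≤ (2 * L) ^ 2 + τ := by
  have h1 := variance_le (x := x) (x' := x') hK hh hlam hn X hv
    (linkWeight_le_one hK hh hlam hn X)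
  have h2 : |f x x' - ∑ p, linkWeight K h lam x x' X p * f (X p.1.1) (X p.1.2)| ≤ 2 * L := by
    refine (abs_bias_le hK hh hlam hn X hf.1).trans ?_
    rw [div_le_iff₀ (totalWeight_pos hK hh hlam hn X), totalWeight, Finset.mul_sum]
    refine Finset.sum_le_sum fun p _ => ?_
    rw [mul_comm]
    refine mul_le_mul_of_nonneg_right ?_ (pairWeight_pos hK hh hlam X _ _).le
    refine (abs_sub _ _).trans ?_
    linarith [hf.2.2 x x', hf.2.2 (X p.1) (X p.2)]
  have h3 := sq_le_sq' (abs_le.1 h2).1 (abs_le.1 h2).2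
  linarith

lemma holder_two {β L : ℝ} {f : 𝒳 → 𝒳 → ℝ} (hf : f ∈ holderClass 𝒳 β L) (a b a' b' : 𝒳) :
    |f a b - f a' b'| ≤ L * ‖(a : Space d) - a'‖ ^ β + L * ‖(b : Space d) - b'‖ ^ β := by
  have h1 := hf.2.1 a a' b
  have h2 := hf.2.1 b b' a'
  rw [hf.1 b a', hf.1 b' a'] at h2
  exact (abs_sub_le _ _ _).trans (add_le_add h1 h2)

lemma norm_le_of_scaledKernel_ne_zero {R : ℝ} (hR : ∀ z, K z ≠ 0 → ‖z‖ ≤ R) (hh : 0 < h)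
    {z : Space d} (hz : scaledKernel K h z ≠ 0) : ‖z‖ ≤ R * h := by
  have := hR _ (right_ne_zero_of_mul hz)
  rwa [norm_smul, norm_inv, Real.norm_of_nonneg hh.le, inv_mul_le_iff₀ hh, mul_comm] at this

/-- Each weight splits into a kernel part and the constant `lam`. Where the kernel part is nonzero
both end points are within `R h` of the queries and Hölder continuity applies. The constant part
only sees the bound `2 L`, over at most `n²` pairs. -/
lemma abs_bias_le_of_holder (hK : ∀ z, 0 ≤ K z) (hh : 0 < h) (hlam : 0 < lam) (hn : 2 ≤ n)
    (X : Fin n → 𝒳) {β L : ℝ} (hβ : 0 < β) (hL : 0 < L) {f : 𝒳 → 𝒳 → ℝ}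
    (hf : f ∈ holderClass 𝒳 β L) {R : ℝ} (hR0 : 0 ≤ R) (hR : ∀ z, K z ≠ 0 → ‖z‖ ≤ R) :
    |f x x' - ∑ p, linkWeight K h lam x x' X p * f (X p.1.1) (X p.1.2)| ≤
      2 * L * (R * h) ^ β + 2 * L * lam * n ^ 2 / totalWeight K h lam x x' X := by
  have hD := totalWeight_pos (x := x) (x' := x') hK hh hlam hn X
  refine (abs_bias_le hK hh hlam hn X hf.1).trans ?_
  rw [div_le_iff₀ hD, add_mul, div_mul_cancel₀ _ hD.ne']
  have hpt : ∀ p : Fin n × Fin n,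
      pairWeight K h lam x x' X p.1 p.2 * |f x x' - f (X p.1) (X p.2)| ≤
        2 * L * (R * h) ^ β * pairWeight K h lam x x' X p.1 p.2 + 2 * L * lam := by
    intro p
    have hb : |f x x' - f (X p.1) (X p.2)| ≤ 2 * L := by
      refine (abs_sub _ _).trans ?_
      linarith [hf.2.2 x x', hf.2.2 (X p.1) (X p.2)]
    have hrh : 0 ≤ (R * h) ^ β := by positivity
    unfold pairWeight
    set s := scaledKernel K h ((x : Space d) - (X p.1 : Space d)) with hs
    set t := scaledKernel K h ((x' : Space d) - (X p.2 : Space d)) with ht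
    have hs0 : 0 ≤ s := scaledKernel_nonneg hK hh _
    have ht0 : 0 ≤ t := scaledKernel_nonneg hK hh _
    have h1 : s * t * |f x x' - f (X p.1) (X p.2)| ≤ s * t * (2 * L * (R * h) ^ β) := by
      by_cases hst : s * t = 0
      · simp [hst]
      · refine mul_le_mul_of_nonneg_left ((holder_two hf _ _ _ _).trans ?_) (by positivity)
        have e1 := norm_le_of_scaledKernel_ne_zero hR hh (left_ne_zero_of_mul hst)
        have e2 := norm_le_of_scaledKernel_ne_zero hR hh (right_ne_zero_of_mul hst)
        have e1' := Real.rpow_le_rpow (norm_nonneg _) e1 hβ.le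
        have e2' := Real.rpow_le_rpow (norm_nonneg _) e2 hβ.le
        nlinarith
    have h2 : lam * |f x x' - f (X p.1) (X p.2)| ≤ lam * (2 * L) :=
      mul_le_mul_of_nonneg_left hb hlam.le
    have h3 : 0 ≤ 2 * L * (R * h) ^ β * lam := by positivity
    nlinarith
  refine (Finset.sum_le_sum fun p _ => hpt p).trans ?_
  rw [Finset.sum_add_distrib, ← Finset.mul_sum, Finset.sum_const, nsmul_eq_mul]
  refine add_le_add le_rfl ?_
  have hcard : ((Finset.univ.filter (fun p : Fin n × Fin n => p.1 ≠ p.2)).card : ℝ) ≤ n ^ 2 := by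
    have := Finset.card_filter_le (Finset.univ : Finset (Fin n × Fin n)) (fun p => p.1 ≠ p.2)
    rw [Finset.card_univ, Fintype.card_prod, Fintype.card_fin, ← sq] at this
    exact_mod_cast this
  rw [mul_comm]
  gcongr

/-- Only pairs with both ends near their query points are kept. The `- 1` pays for the diagonal: at
most one excluded pair for each index near `x`, which matters when the two neighbourhoods overlap.
-/
lemma le_totalWeight (hK : ∀ z, 0 ≤ K z) (hh : 0 < h) (hlam : 0 < lam)
    (X : Fin n → 𝒳) {k r : ℝ} (hk : 0 ≤ k) (hr : ∀ z, ‖z‖ ≤ r → k ≤ K z) :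
    ((nearIdx X (x : Space d) (r * h)).card : ℝ) *
        (((nearIdx X (x' : Space d) (r * h)).card : ℝ) - 1) * (k ^ 2 * ((h ^ d)⁻¹) ^ 2) ≤
      totalWeight K h lam x x' X := by
  set A := nearIdx X (x : Space d) (r * h)
  set B := nearIdx X (x' : Space d) (r * h)
  have hker : ∀ (y : 𝒳) (i : Fin n), i ∈ nearIdx X (y : Space d) (r * h) →
      (h ^ d)⁻¹ * k ≤ scaledKernel K h ((y : Space d) - (X i : Space d)) := by
    intro y i hi
    refine mul_le_mul_of_nonneg_left (hr _ ?_) (by positivity)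
    rw [norm_smul, norm_inv, Real.norm_of_nonneg hh.le, inv_mul_le_iff₀ hh, norm_sub_rev, mul_comm]
    exact mem_nearIdx.1 hi
  have hw : ∀ p ∈ (A ×ˢ B).filter (fun p : Fin n × Fin n => p.1 ≠ p.2),
      k ^ 2 * ((h ^ d)⁻¹) ^ 2 ≤ pairWeight K h lam x x' X p.1 p.2 := by
    intro p hp
    obtain ⟨hpA, hpB⟩ := Finset.mem_product.1 (Finset.mem_filter.1 hp).1
    have h1 := mul_le_mul (hker x _ hpA) (hker x' _ hpB) (by positivity)
      (scaledKernel_nonneg hK hh _)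
    unfold pairWeight
    nlinarith
  have hcard : (A.card : ℝ) * ((B.card : ℝ) - 1) ≤
      ((A ×ˢ B).filter (fun p : Fin n × Fin n => p.1 ≠ p.2)).card := by
    have h1 := Finset.card_filter_add_card_filter_not (s := A ×ˢ B)
      (fun p : Fin n × Fin n => p.1 ≠ p.2)
    have h2 : ((A ×ˢ B).filter (fun p : Fin n × Fin n => ¬ p.1 ≠ p.2)).card ≤ A.card := by
      refine Finset.card_le_card_of_injOn Prod.fst ?_ ?_
      · intro p hp
        exact (Finset.mem_product.1 (Finset.mem_filter.1 hp).1).1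
      · intro p hp q hq hpq
        have hp' := not_not.1 (Finset.mem_filter.1 hp).2
        have hq' := not_not.1 (Finset.mem_filter.1 hq).2
        exact Prod.ext hpq (hp'.symm.trans (hpq.trans hq'))
    rw [Finset.card_product] at h1
    have h1' : (((A ×ˢ B).filter (fun p : Fin n × Fin n => p.1 ≠ p.2)).card : ℝ) +
        ((A ×ˢ B).filter (fun p : Fin n × Fin n => ¬ p.1 ≠ p.2)).card = A.card * B.card := by
      exact_mod_cast h1
    have h2' : (((A ×ˢ B).filter (fun p : Fin n × Fin n => ¬ p.1 ≠ p.2)).card : ℝ) ≤ A.card := by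
      exact_mod_cast h2
    linarith
  calc (A.card : ℝ) * ((B.card : ℝ) - 1) * (k ^ 2 * ((h ^ d)⁻¹) ^ 2)
      ≤ ((A ×ˢ B).filter (fun p : Fin n × Fin n => p.1 ≠ p.2)).card *
          (k ^ 2 * ((h ^ d)⁻¹) ^ 2) := by gcongr
    _ ≤ ∑ p ∈ (A ×ˢ B).filter (fun p : Fin n × Fin n => p.1 ≠ p.2),
          pairWeight K h lam x x' X p.1 p.2 := by
        rw [← nsmul_eq_mul]
        exact Finset.card_nsmul_le_sum _ _ _ hw
    _ ≤ totalWeight K h lam x x' X :=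
        Finset.sum_le_sum_of_subset_of_nonneg
          (Finset.filter_subset_filter _ (Finset.subset_univ _))
          fun p _ _ => (pairWeight_pos hK hh hlam X _ _).le

lemma linkWeight_le (hK : ∀ z, 0 ≤ K z) (hh : 0 < h) (hlam : 0 < lam) (hn : 2 ≤ n)
    (X : Fin n → 𝒳) {M : ℝ} (hM : ∀ z, K z ≤ M) (p : Link n) :
    linkWeight K h lam x x' X p ≤
      2 * (M ^ 2 * ((h ^ d)⁻¹) ^ 2 + lam) / totalWeight K h lam x x' X := by
  have hpair : ∀ i j, pairWeight K h lam x x' X i j ≤ M ^ 2 * ((h ^ d)⁻¹) ^ 2 + lam := by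
    intro i j
    have hsk : ∀ z, scaledKernel K h z ≤ (h ^ d)⁻¹ * M := fun z =>
      mul_le_mul_of_nonneg_left (hM _) (by positivity)
    have := mul_le_mul (hsk ((x : Space d) - (X i : Space d)))
      (hsk ((x' : Space d) - (X j : Space d))) (scaledKernel_nonneg hK hh _)
      (mul_nonneg (by positivity) ((hK 0).trans (hM 0)))
    unfold pairWeight
    nlinarith
  refine div_le_div_of_nonneg_right ?_ (totalWeight_pos hK hh hlam hn X).le
  linarith [hpair p.1.1 p.1.2, hpair p.1.2 p.1.1]

end Smoother

/-! ### Positivity of the kernel's supremum and its support radius. -/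

section KernelFacts

variable {d : ℕ} {K : Space d → ℝ}

/-- Turns the relative lower bound in `lower_on_ball` into a positive absolute one. -/
lemma IsKernel.iSup_pos (hK : IsKernel K) : 0 < ⨆ w, K w := by
  by_contra hneg
  have h0 : ∀ z, K z = 0 := fun z =>
    le_antisymm ((le_ciSup hK.bounded z).trans (not_lt.1 hneg)) (hK.nonneg z)
  have := hK.integral_eq_one
  simp [h0] at this

lemma IsKernel.exists_radius (hK : IsKernel K) : ∃ R : ℝ, 0 ≤ R ∧ ∀ z, K z ≠ 0 → ‖z‖ ≤ R := by
  obtain ⟨R, hR⟩ := hK.compactSupport.isBounded.subset_closedBall 0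
  refine ⟨max R 0, le_max_right _ _, fun z hz => le_max_of_le_left ?_⟩
  simpa using hR (subset_tsupport _ (Function.mem_support.2 hz))

end KernelFacts

/-! ### The upper bound for the smoother. -/

section UpperBound

variable {d n : ℕ} {𝒳 : Set (Space d)} {K : Space d → ℝ} {h lam : ℝ} {x x' : 𝒳}

/-- The conditional risk when there are enough design points near both query points. -/
lemma conditional_risk_le_of_near (hd : 0 < d) (hK : ∀ z, 0 ≤ K z) (hh : 0 < h) (hh1 : h ≤ 1)
    (hlam : 0 < lam) (hlamh : lam ≤ h ^ d) (hn : 2 ≤ n) (X : Fin n → 𝒳) {β L : ℝ} (hβ : 0 < β)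
    (hβ1 : β ≤ 1) (hL : 0 < L) {f : 𝒳 → 𝒳 → ℝ} (hf : f ∈ holderClass 𝒳 β L)
    {v : 𝒳 → 𝒳 → ℝ≥0} {τ : ℝ≥0} (hv : ∀ a b, v a b ≤ τ) {R : ℝ} (hR0 : 0 ≤ R)
    (hR : ∀ z, K z ≠ 0 → ‖z‖ ≤ R) {M : ℝ} (hM : ∀ z, K z ≤ M) {k r : ℝ} (hk : 0 < k)
    (hr : ∀ z, ‖z‖ ≤ r → k ≤ K z) (hq : (n : ℝ) * h ^ d = (h ^ β)⁻¹) {c c' : ℝ} (hc : 0 < c)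
    (hc' : 0 < c') (hq2 : 2 ≤ c' * (n * h ^ d))
    (hx : c * (n * h ^ d) ≤ (nearIdx X (x : Space d) (r * h)).card)
    (hx' : c' * (n * h ^ d) ≤ (nearIdx X (x' : Space d) (r * h)).card) :
    (f x x' - ∑ p, linkWeight K h lam x x' X p * f (X p.1.1) (X p.1.2)) ^ 2 +
        ∑ p, linkWeight K h lam x x' X p ^ 2 * v (X p.1.1) (X p.1.2) ≤
      ((2 * L * R ^ β + 2 * L / (c * c' * k ^ 2 / 2)) ^ 2 +
        2 * (M ^ 2 + 1) / (c * c' * k ^ 2 / 2) * τ) * h ^ (2 * β) := by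
  set c₀ := c * c' * k ^ 2 / 2 with hc₀
  have hc₀pos : 0 < c₀ := by positivity
  have hn0 : (0 : ℝ) < n := by exact_mod_cast (by omega : 0 < n)
  have hhd : 0 < h ^ d := by positivity
  have hhβ : 0 < h ^ β := by positivity
  have hD : c₀ * n ^ 2 ≤ totalWeight K h lam x x' X := by
    refine le_trans ?_ (le_totalWeight hK hh hlam X hk.le hr)
    -- The assumption `hq2` lets half of the count absorb the diagonal correction. This is the
    -- source of the factor `1/2` in `c₀`.
    have h1 : c' * (n * h ^ d) / 2 ≤ (nearIdx X (x' : Space d) (r * h)).card - 1 := by linarith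
    calc c₀ * n ^ 2 = (c * (n * h ^ d)) * (c' * (n * h ^ d) / 2) * (k ^ 2 * ((h ^ d)⁻¹) ^ 2) := by
          rw [hc₀]
          field_simp
      _ ≤ _ := by gcongr
  have hDpos : 0 < totalWeight K h lam x x' X := lt_of_lt_of_le (by positivity) hD
  have hhdβ : h ^ d ≤ h ^ β := by
    rw [← Real.rpow_natCast]
    refine Real.rpow_le_rpow_of_exponent_ge hh hh1 (hβ1.trans ?_)
    exact_mod_cast hd
  have hbias := abs_bias_le_of_holder (x := x) (x' := x') hK hh hlam hn X hβ hL hf hR0 hR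
  have hbias' : |f x x' - ∑ p, linkWeight K h lam x x' X p * f (X p.1.1) (X p.1.2)| ≤
      (2 * L * R ^ β + 2 * L / c₀) * h ^ β := by
    refine hbias.trans ?_
    rw [Real.mul_rpow hR0 hh.le, add_mul, ← mul_assoc]
    refine add_le_add le_rfl ?_
    calc 2 * L * lam * n ^ 2 / totalWeight K h lam x x' X ≤ 2 * L * lam * n ^ 2 / (c₀ * n ^ 2) := by
          gcongr
      _ = 2 * L / c₀ * lam := by field_simp
      _ ≤ 2 * L / c₀ * h ^ β := by
          gcongr
          exact hlamh.trans hhdβ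
  have hvar := variance_le (x := x) (x' := x') hK hh hlam hn X hv
    (fun p => linkWeight_le hK hh hlam hn X hM p)
  have hwt : 2 * (M ^ 2 * ((h ^ d)⁻¹) ^ 2 + lam) / totalWeight K h lam x x' X ≤
      2 * (M ^ 2 + 1) / c₀ * h ^ (2 * β) := by
    have h1 : lam ≤ ((h ^ d)⁻¹) ^ 2 := by
      have e1 : h ^ d ≤ 1 := pow_le_one₀ hh.le hh1
      exact (hlamh.trans e1).trans (one_le_pow₀ ((one_le_inv₀ hhd).2 e1))
    -- The balance equation again: the largest link weight is of order `h^(-2d) / n²`, which is the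
    -- squared bias scale.
    have h2 : h ^ (2 * β) = ((h ^ d)⁻¹) ^ 2 / n ^ 2 := by
      have e2 : h ^ β = (n * h ^ d)⁻¹ := by rw [hq, inv_inv]
      rw [mul_comm 2 β, Real.rpow_mul hh.le, Real.rpow_ofNat, e2]
      field_simp
    calc 2 * (M ^ 2 * ((h ^ d)⁻¹) ^ 2 + lam) / totalWeight K h lam x x' X
        ≤ 2 * (M ^ 2 * ((h ^ d)⁻¹) ^ 2 + ((h ^ d)⁻¹) ^ 2) / (c₀ * n ^ 2) := by gcongr
      _ = _ := by
        rw [h2]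
        field_simp
  have hvar' := hvar.trans (mul_le_mul_of_nonneg_right hwt (NNReal.coe_nonneg τ))
  have hsq := sq_le_sq' (abs_le.1 hbias').1 (abs_le.1 hbias').2
  have h2β : h ^ (2 * β) = (h ^ β) ^ 2 := by
    rw [mul_comm 2 β, Real.rpow_mul hh.le, Real.rpow_ofNat]
  rw [mul_pow, ← h2β] at hsq
  linarith

/-- The maximal risk of the smoother over designs that rarely leave a neighbourhood of a query
point poorly covered. -/
lemma exists_maxRisk_smoother_le (hd : 0 < d) {β L : ℝ} (hβ : 0 < β) (hβ1 : β ≤ 1) (hL : 0 < L)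
    {v : 𝒳 → 𝒳 → ℝ≥0} {τ : ℝ≥0} (hv : ∀ a b, v a b ≤ τ) (hK : IsKernel K) {lam : ℕ → ℝ}
    (hlam : ∀ n : ℕ, 1 ≤ n → 0 < lam n ∧ lam n ≤ bandwidth β d n ^ d)
    {P : ∀ n : ℕ, Measure (Fin n → 𝒳)} (hP : ∀ n, IsProbabilityMeasure (P n))
    (hfew : ∀ y ∈ ({(x : Space d), (x' : Space d)} : Set (Space d)), ∀ ρ : ℝ, 0 < ρ →
      ∃ c C : ℝ, 0 < c ∧ 0 ≤ C ∧ ∀ᶠ n : ℕ in atTop,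
      P n {X | ((nearIdx X y (ρ * bandwidth β d n)).card : ℝ) < c * (n * bandwidth β d n ^ d)} ≤
        ENNReal.ofReal (C * bandwidth β d n ^ (2 * β))) :
    ∃ C : ℝ, 0 < C ∧ ∀ᶠ n : ℕ in atTop,
      maxRisk β L (P n) v x x' (kernelSmoother K (bandwidth β d n) (lam n) x x' n) ≤
        ENNReal.ofReal (C * bandwidth β d n ^ (2 * β)) := by
  obtain ⟨R, hR0, hR⟩ := hK.exists_radius
  obtain ⟨k, r, hk, hr0, hr⟩ := hK.lower_on_ball
  have hMpos := hK.iSup_pos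
  set M := ⨆ w, K w
  have hM : ∀ z, K z ≤ M := le_ciSup hK.bounded
  obtain ⟨c, C, hc, hC, hfew1⟩ := hfew x (by simp) r hr0
  obtain ⟨c', C', hc', hC', hfew2⟩ := hfew x' (by simp) r hr0
  set A := (2 * L * R ^ β + 2 * L / (c * c' * (k * M) ^ 2 / 2)) ^ 2 +
        2 * (M ^ 2 + 1) / (c * c' * (k * M) ^ 2 / 2) * τ with hA
  have hA0 : 0 < A := by positivity
  have hhβ : ∀ᶠ n : ℕ in atTop, 2 ≤ c' * (n * bandwidth β d n ^ d) := by
    have h1 : Tendsto (fun n : ℕ => bandwidth β d n ^ β) atTop (nhds 0) := by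
      have := (tendsto_bandwidth (d := d) hβ).rpow_const (Or.inr hβ.le)
      rwa [Real.zero_rpow hβ.ne'] at this
    filter_upwards [h1.eventually_le_const (show 0 < c' / 2 by positivity), eventually_ge_atTop 1]
      with n h2 hn
    have h3 : 0 < bandwidth β d n ^ β := Real.rpow_pos_of_pos (bandwidth_pos hn) _
    rw [bandwidth_pow_mul hβ hn, ← div_eq_mul_inv, le_div_iff₀ h3]
    linarith
  refine ⟨A + ((2 * L) ^ 2 + τ) * (C + C'), by positivity, ?_⟩
  filter_upwards [hfew1, hfew2, hhβ, eventually_ge_atTop 2] with n h1 h2 h3 hn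
  obtain ⟨hl0, hl1⟩ := hlam n (by omega)
  have hh0 : 0 < bandwidth β d n := bandwidth_pos (by omega)
  have hh1 : bandwidth β d n ≤ 1 := bandwidth_le_one hβ (by omega)
  have hq := bandwidth_pow_mul (d := d) hβ (show 1 ≤ n by omega)
  set h := bandwidth β d n with hh
  have hhβ0 : 0 < h ^ (2 * β) := by positivity
  -- A measurable hull of the sparse designs has the same measure, so its indicator integrates
  -- without proving measurability of the counts.
  set B := toMeasurable (P n)
    ({X | ((nearIdx X (x : Space d) (r * h)).card : ℝ) < c * (n * h ^ d)} ∪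
      {X | ((nearIdx X (x' : Space d) (r * h)).card : ℝ) < c' * (n * h ^ d)}) with hB
  have hPB : P n B ≤ ENNReal.ofReal ((C + C') * h ^ (2 * β)) := by
    rw [hB, measure_toMeasurable, add_mul, ENNReal.ofReal_add (by positivity) (by positivity)]
    exact (measure_union_le _ _).trans (add_le_add h1 h2)
  refine iSup₂_le fun f hf => ?_
  calc risk (P n) v x x' (kernelSmoother K h (lam n) x x' n) f
      ≤ ∫⁻ X, (ENNReal.ofReal (A * h ^ (2 * β)) +
          B.indicator (fun _ => ENNReal.ofReal ((2 * L) ^ 2 + τ)) X) ∂(P n) := by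
        refine lintegral_mono fun X => ?_
        simp only
        rw [lintegral_smoother K h (lam n) x x' hn X f v]
        by_cases hX : X ∈ B
        · rw [Set.indicator_of_mem hX]
          refine le_trans ?_ le_add_self
          exact ENNReal.ofReal_le_ofReal
            (conditional_risk_le_crude hK.nonneg hh0 hl0 hn X hf hv)
        · refine le_trans ?_ le_self_add
          obtain ⟨hX1, hX2⟩ := not_or.1 fun hmem => hX (subset_toMeasurable _ _ hmem)
          exact ENNReal.ofReal_le_ofReal
            (conditional_risk_le_of_near hd hK.nonneg hh0 hh1 hl0 hl1 hn X hβ hβ1 hL hf hv hR0 hR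
              hM (mul_pos hk hMpos) hr hq hc hc' h3 (not_lt.1 hX1) (not_lt.1 hX2))
    _ = ENNReal.ofReal (A * h ^ (2 * β)) + ENNReal.ofReal ((2 * L) ^ 2 + τ) * P n B := by
        rw [lintegral_add_left measurable_const, lintegral_const, measure_univ, mul_one,
          lintegral_indicator_const (measurableSet_toMeasurable _ _)]
    _ ≤ ENNReal.ofReal (A * h ^ (2 * β)) +
          ENNReal.ofReal ((2 * L) ^ 2 + τ) * ENNReal.ofReal ((C + C') * h ^ (2 * β)) := by gcongr
    _ = _ := by
        rw [← ENNReal.ofReal_mul (by positivity), ← ENNReal.ofReal_add (by positivity)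
          (by positivity)]
        congr 1
        ring

end UpperBound

/-! ### The two-point lower bound. -/

section LowerBound

variable {d : ℕ} {𝒳 : Set (Space d)}

/-- For `β ≤ 1` the map `t ↦ t^β` is subadditive, so `‖a - b‖^β` obeys the triangle inequality. -/
lemma abs_rpow_norm_sub_le {β : ℝ} (hβ : 0 < β) (hβ1 : β ≤ 1) (a b y : Space d) :
    |‖a - y‖ ^ β - ‖b - y‖ ^ β| ≤ ‖a - b‖ ^ β := by
  have key : ∀ a b : Space d, ‖a - y‖ ^ β ≤ ‖a - b‖ ^ β + ‖b - y‖ ^ β := fun a b =>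
    (Real.rpow_le_rpow (norm_nonneg _) (norm_sub_le_norm_sub_add_norm_sub a b y) hβ.le).trans
      (Real.rpow_add_le_add_rpow (norm_nonneg _) (norm_nonneg _) hβ.le hβ1)
  rw [abs_sub_le_iff]
  have h1 := key a b
  have h2 := key b a
  rw [norm_sub_rev b a] at h2
  constructor <;> linarith

/-- A `β`-Hölder bump of height and radius governed by `h` at `y`. -/
noncomputable def bump (β h : ℝ) (y a : Space d) : ℝ := max (h ^ β - ‖a - y‖ ^ β) 0

lemma bump_nonneg (β h : ℝ) (y a : Space d) : 0 ≤ bump β h y a := le_max_right _ _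

lemma bump_le {β h : ℝ} (hh : 0 ≤ h) (y a : Space d) : bump β h y a ≤ h ^ β := by
  have : 0 ≤ h ^ β := by positivity
  have : 0 ≤ ‖a - y‖ ^ β := by positivity
  exact max_le (by linarith) (by assumption)

lemma bump_self {β h : ℝ} (hβ : 0 < β) (hh : 0 ≤ h) (y : Space d) : bump β h y y = h ^ β := by
  simp [bump, Real.zero_rpow hβ.ne', Real.rpow_nonneg hh]

lemma norm_le_of_bump_pos {β h : ℝ} (hβ : 0 < β) (hh : 0 ≤ h) {y a : Space d}
    (ha : 0 < bump β h y a) : ‖a - y‖ ≤ h := by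
  rcases lt_max_iff.1 ha with h1 | h1
  · exact ((Real.rpow_lt_rpow_iff (norm_nonneg _) hh hβ).1 (sub_pos.1 h1)).le
  · exact absurd h1 (lt_irrefl _)

lemma abs_bump_sub_le {β h : ℝ} (hβ : 0 < β) (hβ1 : β ≤ 1) (y a b : Space d) :
    |bump β h y a - bump β h y b| ≤ ‖a - b‖ ^ β := by
  refine (abs_max_sub_max_le_abs _ _ _).trans ?_
  rw [sub_sub_sub_cancel_left, abs_sub_comm]
  exact abs_rpow_norm_sub_le hβ hβ1 a b y

/-- The symmetrized product-type bump at `(x, x')`, the alternative in the lower bound. -/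
noncomputable def pairBump (β h M : ℝ) (x x' : 𝒳) (a b : 𝒳) : ℝ :=
  M * max (min (bump β h (x : Space d) a) (bump β h (x' : Space d) b))
    (min (bump β h (x : Space d) b) (bump β h (x' : Space d) a))

lemma pairBump_self {β h M : ℝ} (hβ : 0 < β) (hh : 0 ≤ h) (x x' : 𝒳) :
    pairBump β h M x x' x x' = M * h ^ β := by
  unfold pairBump
  rw [bump_self hβ hh, bump_self hβ hh, min_self,
    max_eq_left ((min_le_left _ _).trans (bump_le hh _ _))]

lemma pairBump_nonneg {β h M : ℝ} (hM : 0 ≤ M) (x x' a b : 𝒳) : 0 ≤ pairBump β h M x x' a b :=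
  mul_nonneg hM (le_max_of_le_left (le_min (bump_nonneg _ _ _ _) (bump_nonneg _ _ _ _)))

lemma pairBump_le {β h M : ℝ} (hM : 0 ≤ M) (hh : 0 ≤ h) (x x' a b : 𝒳) :
    pairBump β h M x x' a b ≤ M * h ^ β :=
  mul_le_mul_of_nonneg_left
    (max_le ((min_le_left _ _).trans (bump_le hh _ _)) ((min_le_left _ _).trans (bump_le hh _ _)))
    hM

/-- Maxima and minima do not worsen a Hölder constant, so symmetrizing is free and `M ≤ L` suffices.
The sup bound uses `h ≤ 1`. -/
lemma pairBump_mem_holderClass {β h M L : ℝ} (hβ : 0 < β) (hβ1 : β ≤ 1) (hh : 0 < h) (hh1 : h ≤ 1)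
    (hM : 0 ≤ M) (hML : M ≤ L) (x x' : 𝒳) : pairBump β h M x x' ∈ holderClass 𝒳 β L := by
  refine ⟨fun a b => by rw [pairBump, pairBump, max_comm], fun a a' b => ?_, fun a b => ?_⟩
  · unfold pairBump
    rw [← mul_sub, abs_mul, abs_of_nonneg hM]
    refine mul_le_mul hML ?_ (abs_nonneg _) (hM.trans hML)
    have h0 : 0 ≤ ‖(a : Space d) - a'‖ ^ β := by positivity
    refine (abs_max_sub_max_le_max _ _ _ _).trans (max_le ?_ ?_)
    · refine (abs_min_sub_min_le_max _ _ _ _).trans (max_le (abs_bump_sub_le hβ hβ1 _ _ _) ?_)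
      simpa using h0
    · refine (abs_min_sub_min_le_max _ _ _ _).trans (max_le ?_ (abs_bump_sub_le hβ hβ1 _ _ _))
      simpa using h0
  · rw [abs_of_nonneg (pairBump_nonneg hM _ _ _ _)]
    have h1 : h ^ β ≤ 1 := Real.rpow_le_one hh.le hh1 hβ.le
    have h2 := pairBump_le (β := β) hM hh.le x x' a b
    nlinarith

/-- A link carries information about the alternative only when its ends are near the two queries, in
one order or the other. The sum of indicators is then at least `1`. -/
lemma ofReal_pairBump_sq_div_le {β h M : ℝ} (hβ : 0 < β) (hh : 0 < h) (hM : 0 ≤ M) {v v₀ : ℝ≥0}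
    (hv₀ : 0 < v₀) (hv : v₀ ≤ v) (x x' a b : 𝒳) :
    ENNReal.ofReal (pairBump β h M x x' a b ^ 2 / v) ≤
      ENNReal.ofReal ((M * h ^ β) ^ 2 / v₀) *
        ((nearSet 𝒳 (x : Space d) h).indicator (1 : 𝒳 → ℝ≥0∞) a *
            (nearSet 𝒳 (x' : Space d) h).indicator (1 : 𝒳 → ℝ≥0∞) b +
          (nearSet 𝒳 (x' : Space d) h).indicator (1 : 𝒳 → ℝ≥0∞) a *
            (nearSet 𝒳 (x : Space d) h).indicator (1 : 𝒳 → ℝ≥0∞) b) := by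
  by_cases h0 : pairBump β h M x x' a b = 0
  · simp [h0]
  have hpos := lt_of_le_of_ne (pairBump_nonneg hM x x' a b) (Ne.symm h0)
  have hmax := pos_of_mul_pos_right hpos hM
  have hone : (1 : ℝ≥0∞) ≤ (nearSet 𝒳 (x : Space d) h).indicator (1 : 𝒳 → ℝ≥0∞) a *
            (nearSet 𝒳 (x' : Space d) h).indicator (1 : 𝒳 → ℝ≥0∞) b +
          (nearSet 𝒳 (x' : Space d) h).indicator (1 : 𝒳 → ℝ≥0∞) a *
            (nearSet 𝒳 (x : Space d) h).indicator (1 : 𝒳 → ℝ≥0∞) b := by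
    rcases lt_max_iff.1 hmax with h1 | h1
    · have ha : a ∈ nearSet 𝒳 (x : Space d) h := norm_le_of_bump_pos hβ hh.le (lt_min_iff.1 h1).1
      have hb : b ∈ nearSet 𝒳 (x' : Space d) h := norm_le_of_bump_pos hβ hh.le (lt_min_iff.1 h1).2
      simp [ha, hb]
    · have ha : b ∈ nearSet 𝒳 (x : Space d) h := norm_le_of_bump_pos hβ hh.le (lt_min_iff.1 h1).1
      have hb : a ∈ nearSet 𝒳 (x' : Space d) h := norm_le_of_bump_pos hβ hh.le (lt_min_iff.1 h1).2
      simp [ha, hb]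
  refine le_trans (ENNReal.ofReal_le_ofReal ?_) (le_mul_of_one_le_right zero_le hone)
  have h1 := pairBump_le (β := β) hM hh.le x x' a b
  have h2 : (v₀ : ℝ) ≤ v := by exact_mod_cast hv
  have h3 : (0 : ℝ) < v₀ := by exact_mod_cast hv₀
  gcongr

lemma outcomeLaw_zero_eq_map {n : ℕ} (v : 𝒳 → 𝒳 → ℝ≥0) (X : Fin n → 𝒳) :
    outcomeLaw (fun _ _ => 0) v X =
      (Measure.pi fun _ : Link n => gaussianReal 0 1).map
        fun Z p => Real.sqrt (v (X p.1.1) (X p.1.2)) * Z p := by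
  rw [Measure.pi_map_pi (f := fun (p : Link n) z => Real.sqrt (v (X p.1.1) (X p.1.2)) * z)
    fun p => by fun_prop]
  unfold outcomeLaw
  congr 1
  ext1 p
  rw [gaussianReal_map_const_mul]
  congr 1
  · simp
  · ext
    simp

/-- The centred law is a rescaled standard Gaussian, so the dependence on `X` moves from the measure
into the integrand, and Tonelli's measurability statement applies. -/
lemma measurable_lintegral_outcomeLaw_zero {n : ℕ} {v : 𝒳 → 𝒳 → ℝ≥0}
    (hv : Measurable (Function.uncurry v)) {g : (Fin n → 𝒳) × (Link n → ℝ) → ℝ≥0∞}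
    (hg : Measurable g) :
    Measurable fun X => ∫⁻ Y, g (X, Y) ∂(outcomeLaw (fun _ _ => 0) v X) := by
  have hs : Measurable fun q : (Fin n → 𝒳) × (Link n → ℝ) =>
      fun p : Link n => Real.sqrt (v (q.1 p.1.1) (q.1 p.1.2)) * q.2 p := by
    refine measurable_pi_lambda _ fun p => Measurable.mul ?_ (by fun_prop)
    have h1 : Measurable fun q : (Fin n → 𝒳) × (Link n → ℝ) => (q.1 p.1.1, q.1 p.1.2) := by
      fun_prop
    exact (hv.comp h1).coe_nnreal_real.sqrt
  have heq : ∀ X : Fin n → 𝒳, ∫⁻ Y, g (X, Y) ∂(outcomeLaw (fun _ _ => 0) v X) =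
      ∫⁻ Z, g (X, fun p => Real.sqrt (v (X p.1.1) (X p.1.2)) * Z p)
        ∂(Measure.pi fun _ : Link n => gaussianReal 0 1) := by
    intro X
    rw [outcomeLaw_zero_eq_map, lintegral_map (by fun_prop) (by fun_prop)]
  simp_rw [heq]
  exact (hg.comp (measurable_fst.prodMk hs)).lintegral_prod_right'

/-- The lower bound for the minimax risk, from a bound for the expected number of links whose end
points are near the two query points. -/
lemma exists_le_minimaxRisk {β L : ℝ} (hβ : 0 < β) (hβ1 : β ≤ 1) (hL : 0 < L)
    {v : 𝒳 → 𝒳 → ℝ≥0} (hv_meas : Measurable (Function.uncurry v)) {v₀ : ℝ≥0} (hv₀ : 0 < v₀)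
    (hv : ∀ a b, v₀ ≤ v a b) (x x' : 𝒳)
    {P : ∀ n : ℕ, Measure (Fin n → 𝒳)} (hP : ∀ n, IsProbabilityMeasure (P n))
    (hpairs : ∀ y y' : Space d, ∃ C : ℝ, 0 ≤ C ∧ ∀ᶠ n : ℕ in atTop,
      ∫⁻ X, ∑ p : Link n, (nearSet 𝒳 y (bandwidth β d n)).indicator (1 : 𝒳 → ℝ≥0∞) (X p.1.1) *
          (nearSet 𝒳 y' (bandwidth β d n)).indicator (1 : 𝒳 → ℝ≥0∞) (X p.1.2) ∂(P n) ≤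
        ENNReal.ofReal (C * (n * bandwidth β d n ^ d) ^ 2)) :
    ∃ c : ℝ, 0 < c ∧ ∀ᶠ n : ℕ in atTop,
      ENNReal.ofReal (c * bandwidth β d n ^ (2 * β)) ≤ minimaxRisk β L (P n) v x x' := by
  obtain ⟨C₁, hC₁, hpair1⟩ := hpairs x x'
  obtain ⟨C₂, hC₂, hpair2⟩ := hpairs x' x
  have hv₀' : (0 : ℝ) < v₀ := by exact_mod_cast hv₀
  obtain ⟨M, hM0, hML, hMC⟩ : ∃ M : ℝ, 0 < M ∧ M ≤ L ∧ M ^ 2 / v₀ * (C₁ + C₂) ≤ 1 / 2 := by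
    -- The `+ 1` keeps the denominator positive if both pair constants vanish. The bound `δ² ≤ δ`
    -- then makes the choice linear in `δ`.
    have hq : 0 < v₀ / (2 * L ^ 2 * (C₁ + C₂ + 1)) := by positivity
    set δ := min 1 (v₀ / (2 * L ^ 2 * (C₁ + C₂ + 1))) with hδ
    have hδ0 : 0 < δ := lt_min one_pos hq
    have hδ1 : δ ≤ 1 := min_le_left _ _
    have hδ2 : δ * (2 * L ^ 2 * (C₁ + C₂ + 1)) ≤ v₀ :=
      (le_div_iff₀ (by positivity)).1 (min_le_right _ _)
    refine ⟨δ * L, by positivity, mul_le_of_le_one_left hL.le hδ1, ?_⟩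
    rw [div_mul_eq_mul_div, div_le_iff₀ hv₀']
    have h1 : δ ^ 2 ≤ δ := by nlinarith
    have h2 : δ ^ 2 * (L ^ 2 * (C₁ + C₂)) ≤ δ * (L ^ 2 * (C₁ + C₂ + 1)) := by
      refine mul_le_mul h1 (mul_le_mul_of_nonneg_left (by linarith) (sq_nonneg L)) ?_ hδ0.le
      positivity
    rw [mul_pow]
    linarith
  refine ⟨M ^ 2 / 8, by positivity, ?_⟩
  filter_upwards [hpair1, hpair2, eventually_ge_atTop 1] with n hn1 hn2 hn
  have hh0 : 0 < bandwidth β d n := bandwidth_pos hn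
  have hh1 : bandwidth β d n ≤ 1 := bandwidth_le_one hβ hn
  have hq := bandwidth_pow_mul (d := d) hβ hn
  set h := bandwidth β d n with hh
  have hhβ : 0 < h ^ β := by positivity
  have h2β : h ^ (2 * β) = (h ^ β) ^ 2 := by
    rw [mul_comm 2 β, Real.rpow_mul hh0.le, Real.rpow_ofNat]
  let ind : 𝒳 → 𝒳 → ℝ≥0∞ := fun y => (nearSet 𝒳 (y : Space d) h).indicator 1
  have hind : ∀ y, Measurable (ind y) := fun y =>
    measurable_one.indicator (measurableSet_nearSet _ _ _)
  have hindle : ∀ y a, ind y a ≤ 1 := fun y a =>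
    Set.indicator_le_self' (f := (1 : 𝒳 → ℝ≥0∞)) (by simp) a
  let W₁ : (Fin n → 𝒳) → ℝ≥0∞ := fun X => ∑ p : Link n, ind x (X p.1.1) * ind x' (X p.1.2)
  let W₂ : (Fin n → 𝒳) → ℝ≥0∞ := fun X => ∑ p : Link n, ind x' (X p.1.1) * ind x (X p.1.2)
  have hind' : ∀ (y : 𝒳) (i : Fin n), Measurable fun X : Fin n → 𝒳 => ind y (X i) := fun y i =>
    (hind y).comp (measurable_pi_apply i)
  have hW : ∀ y y' : 𝒳, Measurable fun X : Fin n → 𝒳 =>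
      ∑ p : Link n, ind y (X p.1.1) * ind y' (X p.1.2) := fun y y' =>
    Finset.measurable_sum _ fun p _ => (hind' y p.1.1).mul (hind' y' p.1.2)
  have hW₁ : Measurable W₁ := hW x x'
  have hW₂ : Measurable W₂ := hW x' x
  have hW₁₂ : Measurable fun X => W₁ X + W₂ X := hW₁.add hW₂
  have hWtop : ∀ (y y' : 𝒳) (X : Fin n → 𝒳),
      ∑ p : Link n, ind y (X p.1.1) * ind y' (X p.1.2) ≠ ⊤ := fun y y' X =>
    ENNReal.sum_ne_top.2 fun p _ => ENNReal.mul_ne_top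
      ((hindle _ _).trans_lt ENNReal.one_lt_top).ne ((hindle _ _).trans_lt ENNReal.one_lt_top).ne
  set θ := M * h ^ β with hθ
  set F := pairBump β h M x x' with hF
  have hFmem : F ∈ holderClass 𝒳 β L := pairBump_mem_holderClass hβ hβ1 hh0 hh1 hM0.le hML x x'
  have h0mem : (fun _ _ => 0 : 𝒳 → 𝒳 → ℝ) ∈ holderClass 𝒳 β L :=
    ⟨fun _ _ => rfl, fun a a' b => by simp; positivity, fun _ _ => by simp [hL.le]⟩
  refine le_iInf₂ fun T hT => ?_
  let A : (Fin n → 𝒳) → ℝ≥0∞ := fun X =>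
    ∫⁻ Y, ENNReal.ofReal ((0 - T (X, Y)) ^ 2) ∂(outcomeLaw (fun _ _ => 0) v X)
  let B : (Fin n → 𝒳) → ℝ≥0∞ := fun X =>
    ∫⁻ Y, ENNReal.ofReal ((F x x' - T (X, Y)) ^ 2) ∂(outcomeLaw F v X)
  have hAm : Measurable A := measurable_lintegral_outcomeLaw_zero hv_meas
    (g := fun q => ENNReal.ofReal ((0 - T q) ^ 2)) (by fun_prop)
  -- The negative part of the two-point bound is moved to the right-hand side, since
  -- `ENNReal.ofReal` would truncate it wherever `S > 1`.
  have hpt : ∀ X, ENNReal.ofReal (θ ^ 2 / 2) ≤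
      A X + (B X + ENNReal.ofReal (θ ^ 2 / 2 * (θ ^ 2 / v₀)) * (W₁ X + W₂ X)) := by
    intro X
    set S := (ENNReal.ofReal (θ ^ 2 / v₀) * (W₁ X + W₂ X)).toReal with hS
    have htop : ENNReal.ofReal (θ ^ 2 / v₀) * (W₁ X + W₂ X) ≠ ⊤ :=
      ENNReal.mul_ne_top ENNReal.ofReal_ne_top
        (ENNReal.add_ne_top.2 ⟨hWtop x x' X, hWtop x' x X⟩)
    have hle : ∑ p : Link n, F (X p.1.1) (X p.1.2) ^ 2 / v (X p.1.1) (X p.1.2) ≤ S := by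
      rw [hS, ← ENNReal.ofReal_le_iff_le_toReal htop,
        ENNReal.ofReal_sum_of_nonneg fun p _ => by positivity, ← Finset.sum_add_distrib,
        Finset.mul_sum]
      exact Finset.sum_le_sum fun p _ =>
        ofReal_pairBump_sq_div_le hβ hh0 hM0.le hv₀ (hv _ _) x x' _ _
    have key := gaussian_two_point (fun p : Link n => F (X p.1.1) (X p.1.2))
      (fun p => v (X p.1.1) (X p.1.2)) (fun p => (hv₀.trans_le (hv _ _)).ne')
      (fun Y => T (X, Y)) (by fun_prop) (F x x') S hle
    have hFx : F x x' = θ := pairBump_self hβ hh0.le x x'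
    have hkey : ENNReal.ofReal (θ ^ 2 / 2 * (1 - S)) ≤ A X + B X := by
      rw [← hFx]
      exact key
    calc ENNReal.ofReal (θ ^ 2 / 2)
        ≤ ENNReal.ofReal (θ ^ 2 / 2 * (1 - S)) + ENNReal.ofReal (θ ^ 2 / 2 * S) := by
          refine le_trans (le_of_eq ?_) ENNReal.ofReal_add_le
          congr 1
          ring
      _ ≤ (A X + B X) + ENNReal.ofReal (θ ^ 2 / 2 * (θ ^ 2 / v₀)) * (W₁ X + W₂ X) := by
          refine add_le_add hkey (le_of_eq ?_)
          rw [ENNReal.ofReal_mul (by positivity), hS, ENNReal.ofReal_toReal htop, ← mul_assoc,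
            ← ENNReal.ofReal_mul (by positivity)]
      _ = _ := add_assoc _ _ _
  set R := maxRisk β L (P n) v x x' T with hR
  have hRA : ∫⁻ X, A X ∂(P n) ≤ R := le_iSup₂_of_le (fun _ _ => 0) h0mem le_rfl
  have hRB : ∫⁻ X, B X ∂(P n) ≤ R := le_iSup₂_of_le F hFmem le_rfl
  have hWint : ∫⁻ X, (W₁ X + W₂ X) ∂(P n) ≤ ENNReal.ofReal ((C₁ + C₂) * (n * h ^ d) ^ 2) := by
    rw [lintegral_add_left hW₁, add_mul, ENNReal.ofReal_add (by positivity) (by positivity)]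
    exact add_le_add hn1 hn2
  have hfin : ENNReal.ofReal (θ ^ 2 / 2) ≤ 2 * R + ENNReal.ofReal (θ ^ 2 / 4) := by
    calc ENNReal.ofReal (θ ^ 2 / 2)
        = ∫⁻ _, ENNReal.ofReal (θ ^ 2 / 2) ∂(P n) := by
          rw [lintegral_const, measure_univ, mul_one]
      _ ≤ _ := lintegral_mono hpt
      -- Splitting the integral needs only `A` and the link counts to be measurable; `B` is the
      -- summand left over.
      _ = ∫⁻ X, A X ∂(P n) + (∫⁻ X, B X ∂(P n) +
            ENNReal.ofReal (θ ^ 2 / 2 * (θ ^ 2 / v₀)) * ∫⁻ X, (W₁ X + W₂ X) ∂(P n)) := by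
          rw [lintegral_add_left hAm, lintegral_add_right _ (hW₁₂.const_mul _),
            lintegral_const_mul _ hW₁₂]
      _ ≤ R + (R + ENNReal.ofReal (θ ^ 2 / 2 * (θ ^ 2 / v₀)) *
            ENNReal.ofReal ((C₁ + C₂) * (n * h ^ d) ^ 2)) := by gcongr
      _ ≤ R + (R + ENNReal.ofReal (θ ^ 2 / 4)) := by
          refine add_le_add le_rfl (add_le_add le_rfl ?_)
          rw [← ENNReal.ofReal_mul (by positivity)]
          refine ENNReal.ofReal_le_ofReal ?_
          -- At this bandwidth the expected information does not depend on `n`: the factor `h^(2β)`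
          -- in `θ²` cancels the `(n h^d)²` from the link count.
          have e1 : θ ^ 2 / v₀ * ((C₁ + C₂) * (n * h ^ d) ^ 2) = M ^ 2 / v₀ * (C₁ + C₂) := by
            rw [hq, hθ]
            field_simp
          rw [mul_assoc, e1]
          nlinarith [sq_nonneg θ]
      _ = _ := by rw [← add_assoc, two_mul]
  have e2 : θ ^ 2 / 2 = θ ^ 2 / 4 + θ ^ 2 / 4 := by ring
  rw [e2, ENNReal.ofReal_add (by positivity) (by positivity)] at hfin
  have h4 := (ENNReal.add_le_add_iff_right ENNReal.ofReal_ne_top).1 hfin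
  have e3 : θ ^ 2 / 4 = 2 * (M ^ 2 / 8 * h ^ (2 * β)) := by
    rw [h2β, hθ]
    ring
  rw [e3, ENNReal.ofReal_mul (by norm_num), ENNReal.ofReal_ofNat] at h4
  exact (ENNReal.mul_le_mul_iff_right (by norm_num) (by norm_num)).1 h4

end LowerBound

/-! ### Assembly for both designs. -/

lemma isProbabilityMeasure_of_design {d : ℕ} {𝒳 : Set (Space d)} (h𝒳 : MeasurableSet 𝒳)
    {P : ∀ n : ℕ, Measure (Fin n → 𝒳)} (hP : IsFixedDesign 𝒳 P ∨ IsRandomDesign 𝒳 P) (n : ℕ) :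
    IsProbabilityMeasure (P n) := by
  rcases hP with ⟨X, c, C, -, -, -, hP⟩ | hP
  · rw [hP n]
    infer_instance
  · obtain ⟨μ, l, u, hμ, -, -, -, hP⟩ := hP.exists_law h𝒳
    rw [hP n]
    infer_instance

end LinkRegression

theorem theorem3 {d : ℕ} (hd : 0 < d)
    (𝒳 : Set (LinkRegression.Space d)) (h𝒳 : IsCompact 𝒳)
    (x x' : 𝒳) (hx : LinkRegression.IsThickAt 𝒳 x) (hx' : LinkRegression.IsThickAt 𝒳 x')
    (β L : ℝ) (hβ : 0 < β) (hβ1 : β ≤ 1) (hL : 0 < L)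
    (v : 𝒳 → 𝒳 → ℝ≥0) (hv_meas : Measurable (Function.uncurry v))
    (hv_symm : ∀ a b, v a b = v b a)
    (hv_upper : ∃ τ : ℝ≥0, ∀ a b, v a b < τ)
    (hv_lower : ∃ v₀ : ℝ≥0, 0 < v₀ ∧ ∀ a b, v₀ ≤ v a b)
    (K : LinkRegression.Space d → ℝ) (hK : LinkRegression.IsKernel K)
    (lam : ℕ → ℝ)
    (hlam : ∃ ν : ℝ, 0 < ν ∧ ∀ n : ℕ, 1 ≤ n →
      1 / ((n : ℝ) * LinkRegression.bandwidth β d n ^ d) ^ ν ≤ lam n ∧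
        lam n ≤ LinkRegression.bandwidth β d n ^ d)
    (P : ∀ n : ℕ, Measure (Fin n → 𝒳))
    (hP : LinkRegression.IsFixedDesign 𝒳 P ∨ LinkRegression.IsRandomDesign 𝒳 P) :
    limsup (fun n : ℕ =>
        LinkRegression.maxRisk β L (P n) v x x'
            (LinkRegression.kernelSmoother K (LinkRegression.bandwidth β d n) (lam n) x x' n) /
          LinkRegression.minimaxRisk β L (P n) v x x') atTop < ⊤ ∧
    ∃ c C : ℝ, 0 < c ∧ 0 < C ∧ ∀ᶠ n : ℕ in atTop,
      ENNReal.ofReal (c * (n : ℝ) ^ (-(2 * β / (β + (d : ℝ))))) ≤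
          LinkRegression.minimaxRisk β L (P n) v x x' ∧
        LinkRegression.minimaxRisk β L (P n) v x x' ≤
          ENNReal.ofReal (C * (n : ℝ) ^ (-(2 * β / (β + (d : ℝ))))) := by
  have hmeas : MeasurableSet 𝒳 := h𝒳.measurableSet
  have hprob := LinkRegression.isProbabilityMeasure_of_design hmeas hP
  obtain ⟨τ, hτ⟩ := hv_upper
  obtain ⟨v₀, hv₀, hv_low⟩ := hv_lower
  obtain ⟨ν, -, hν⟩ := hlam
  have hlam' : ∀ n : ℕ, 1 ≤ n → 0 < lam n ∧ lam n ≤ LinkRegression.bandwidth β d n ^ d := by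
    intro n hn
    have hh : 0 < LinkRegression.bandwidth β d n := LinkRegression.bandwidth_pos hn
    have hn0 : (0 : ℝ) < n := by exact_mod_cast hn
    exact ⟨lt_of_lt_of_le (by positivity) (hν n hn).1, (hν n hn).2⟩
  obtain ⟨C, hC, hupper⟩ := LinkRegression.exists_maxRisk_smoother_le (x := x) (x' := x') hd hβ
    hβ1 hL (fun a b => (hτ a b).le) hK hlam' hprob (by
      intro y hy ρ hρ
      have hthick : LinkRegression.IsThickAt 𝒳 y := by
        rcases hy with rfl | rfl
        exacts [hx, hx']
      rcases hP with hP | hP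
      · exact hP.measure_few_near hd hβ hthick hρ
      · exact hP.measure_few_near hmeas hβ hthick hρ)
  obtain ⟨c, hc, hlower⟩ := LinkRegression.exists_le_minimaxRisk hβ hβ1 hL hv_meas hv₀ hv_low x x'
    hprob (by
      intro y y'
      rcases hP with hP | hP
      · exact hP.lintegral_near_pairs hd hβ y y'
      · exact hP.lintegral_near_pairs hmeas y y')
  refine ⟨?_, c, C, hc, hC, ?_⟩
  -- Numerator and denominator carry the same power `h^(2β)`, so the ratio is eventually at most `C
  -- / c`.
  · refine lt_of_le_of_lt (b := ENNReal.ofReal (C / c)) ?_ ENNReal.ofReal_lt_top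
    refine limsup_le_of_le (by isBoundedDefault) ?_
    filter_upwards [hupper, hlower, eventually_ge_atTop 1] with n h1 h2 hn
    have hpos : 0 < LinkRegression.bandwidth β d n ^ (2 * β) :=
      Real.rpow_pos_of_pos (LinkRegression.bandwidth_pos hn) _
    calc _ ≤ ENNReal.ofReal (C * LinkRegression.bandwidth β d n ^ (2 * β)) /
          ENNReal.ofReal (c * LinkRegression.bandwidth β d n ^ (2 * β)) := ENNReal.div_le_div h1 h2
      _ = ENNReal.ofReal (C / c) := by
          rw [← ENNReal.ofReal_div_of_pos (by positivity), mul_div_mul_right _ _ hpos.ne']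
  · filter_upwards [hupper, hlower] with n h1 h2
    rw [LinkRegression.bandwidth_rpow] at h1 h2
    exact ⟨h2, (iInf₂_le _ (LinkRegression.measurable_kernelSmoother hK.measurable _ _ _ _)).trans
      h1⟩
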